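/- **Conventions.** A discrete-cube morphism $\{0,1\}^m\to\{0,1\}^n$ is the restriction of an affine homomorphism $\mathbb Z^m\to\mathbb Z^n$. An $m$-face of $\{0,1\}^n$ is a subset obtained by fixing $n-m$ coordinates, and an $m$-face map is an injective morphism $\{0,1\}^m\to\{0,1\}^n$ whose image is an $m$-face. A nilspace is a set $X$ with sets $C^n(X)\subseteq X^{\{0,1\}^n}$ ($n\ge 0$) of cubes such that: cubes composed with discrete-cube morphisms are cubes; $C^0(X)=X$ and $C^1(X)=X^{\{0,1\}}$; and for $n\ge 1$ every $n$-corner (a map $\{0,1\}^n\setminus\{1^n\}\to X$ restricting to a cube on each $(n-1)$-face containing $0^n$) extends to a cube in $C^n(X)$. It is $k$-step if every $(k+1)$-corner has exactly one such extension. A nilspace morphism is a map $\psi$ such that $\psi\circ q$ is a cube for every cube $q$. Write $x\sim_i y$ if there are $q_0,q_1\in C^{i+1}(X)$ with $q_0(0^{i+1})=x$, $q_1(0^{i+1})=y$ that agree at all other vertices. For an abelian group $A$, let $C^n(\mathcal D_j(A))$ be the set of $q:\{0,1\}^n\to A$ with $\sum_{v\in\{0,1\}^{j+1}}(-1)^{|v|}q(\phi(v))=0$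 for every face map $\phi:\{0,1\}^{j+1}\to\{0,1\}^n$. A $k$-fold abelian bundle structure on $X$ consists of sets $B_0,\dots,B_k=X$ with $B_0$ a singleton, abelian groups $A_1,\dots,A_k$, free actions of $A_i$ on $B_i$, and maps $B_i\to B_{i-1}$ such that $s\mapsto$ (fibre over $s$) is a bijection from $B_{i-1}$ to the set of $A_i$-orbits in $B_i$; write $\pi_i:X\to B_i$ for the composite projection. It makes the nilspace $X$ a degree-$k$ bundle if, with $C^n(B_i):=\{\pi_i\circ q: q\in C^n(X)\}$, for all $0\le i<k$, all $n\ge 0$ and all $q\in C^n(B_{i+1})$, the elements of $C^n(B_{i+1})$ having the same projection to $B_i$ as $q$ are exactly the maps $q+q_3$ with $q_3\in C^n(\mathcal D_{i+1}(A_{i+1}))$. A bundle morphism between $k$-fold abelian bundles $X,X'$ (with data $B_i,A_i,\pi_i$ and $B_i',A_i',\pi_i'$) is a map $\psi:X\to X'$ such that $\pi_i(x)=\pi_i(y)$ implies $\pi_i'(\psi(x))=\pi_i'(\psi(y))$ for every $i$, so that $\psi$ induces maps $\psi_i:B_i\to B_i'$ with $\psi_i\circ\pi_i=\pi_i'\circ\psi$,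 and such that for every $1\le i\le k$ there is a map $\alpha_i:A_i\to A_i'$ with $\psi_i(b+a)=\psi_i(b)+\alpha_i(a)$ for all $b\in B_i$, $a\in A_i$. **Proposition.** Let $k\ge 0$, let $X,X'$ be non-empty $k$-step nilspaces and let $\psi:X\to X'$ be a nilspace morphism. Then $X$ and $X'$ each admit a structure of degree-$k$ bundle whose factors are the characteristic factors, that is, every $\pi_i$ is onto with $\pi_i(x)=\pi_i(y)\Leftrightarrow x\sim_i y$. Moreover, for every structure of degree-$k$ bundle on $X$ and every such structure on $X'$, the map $\psi$ is a bundle morphism; it induces maps $\psi_i:B_i\to B_i'$ on all factors ($0\le i\le k$), and there are group homomorphisms $\alpha_i:A_i\to A_i'$ ($1\le i\le k$) with $\psi_i(b+a)=\psi_i(b)+\alpha_i(a)$ for all $b\in B_i$, $a\in A_i$. -/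

import Mathlib

universe u v w z w' z'

namespace Nilspaces

/-! ## Discrete cubes -/

/-- The discrete `n`-cube `{0,1}^n`; the vertices `0^n` and `1^n` are `0` and `1`. -/
abbrev Cube (n : ℕ) : Type := Fin n → Fin 2

/-- The inclusion `{0,1}^n ⊆ ℤ^n`. -/
def Cube.toInt {n : ℕ} (x : Cube n) : Fin n → ℤ := fun i => ((x i : ℕ) : ℤ)

/-- A discrete-cube morphism is the restriction of an affine homomorphism `ℤ^m → ℤ^n`. -/
def IsCubeMorphism {m n : ℕ} (φ : Cube m → Cube n) : Prop :=
  ∃ (A : (Fin m → ℤ) →+ (Fin n → ℤ)) (t : Fin n → ℤ), ∀ x, (φ x).toInt = A x.toInt + t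

/-- An `m`-face of `{0,1}^n`: a subset obtained by fixing `n - m` coordinates. -/
def IsFace {n : ℕ} (m : ℕ) (F : Set (Cube n)) : Prop :=
  ∃ (I : Finset (Fin n)) (y : Cube n), I.card + m = n ∧ F = {x | ∀ i ∈ I, x i = y i}

/-- An `m`-face map: an injective morphism whose image is an `m`-face. -/
def IsFaceMap {m n : ℕ} (φ : Cube m → Cube n) : Prop :=
  IsCubeMorphism φ ∧ Function.Injective φ ∧ IsFace m (Set.range φ)

/-- The order-preserving parametrization of the face `{x | x i = 0}` of `{0,1}^(n+1)`. As `i`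
varies, these are all the `n`-faces containing the vertex `0`. -/
def lowerFacet {n : ℕ} (i : Fin (n + 1)) : Cube n → Cube (n + 1) :=
  fun x => Fin.insertNth (α := fun _ => Fin 2) i 0 x

/-! ## Cubespaces and nilspaces -/

/-- A cubespace: a set with collections of cubes, closed under composition with morphisms of
discrete cubes, all of whose points are `0`-cubes. -/
class Cubespace (X : Type u) where
  cubes : (n : ℕ) → Set (Cube n → X)
  comp_mem : ∀ {m n : ℕ} (φ : Cube m → Cube n), IsCubeMorphism φ →
    ∀ q ∈ cubes n, q ∘ φ ∈ cubes m
  cubes_zero : cubes 0 = Set.univ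

/-- `q` restricts to an `(n+1)`-corner on `{0,1}^(n+1) ∖ {1^(n+1)}`. The value of `q` at the
vertex `1` plays no role. -/
def IsCorner {X : Type u} [Cubespace X] {n : ℕ} (q : Cube (n + 1) → X) : Prop :=
  ∀ i : Fin (n + 1), q ∘ lowerFacet i ∈ Cubespace.cubes (X := X) n

/-- `c` is a completion of the corner given by the restriction of `q` to the complement of the
vertex `1`. -/
def IsCompletion {X : Type u} [Cubespace X] {n : ℕ} (q c : Cube (n + 1) → X) : Prop :=
  c ∈ Cubespace.cubes (X := X) (n + 1) ∧ ∀ x, x ≠ 1 → c x = q x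

/-- A nilspace: a cubespace satisfying ergodicity and corner completion. -/
class Nilspace (X : Type u) extends Cubespace X where
  ergodic : cubes 1 = Set.univ
  exists_completion : ∀ {n : ℕ} (q : Cube (n + 1) → X), IsCorner q → ∃ c, IsCompletion q c

/-- A nilspace is `k`-step if every `(k+1)`-corner has a unique completion. -/
def IsStep (k : ℕ) (X : Type u) [Nilspace X] : Prop :=
  ∀ q : Cube (k + 1) → X, IsCorner q → ∃! c, IsCompletion q c

/-- Nilspace morphisms: maps sending cubes to cubes. -/
def IsNilspaceMorphism {X : Type u} {Y : Type v} [Nilspace X] [Nilspace Y] (ψ : X → Y) : Prop :=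
  ∀ (n : ℕ), ∀ q ∈ Cubespace.cubes (X := X) n, ψ ∘ q ∈ Cubespace.cubes (X := Y) n

/-- The relation `∼_k` defining the characteristic factor `X/∼_k`. -/
def Sim {X : Type u} [Nilspace X] (k : ℕ) (x y : X) : Prop :=
  ∃ q₀ ∈ Cubespace.cubes (X := X) (k + 1), ∃ q₁ ∈ Cubespace.cubes (X := X) (k + 1),
    q₀ 0 = x ∧ q₁ 0 = y ∧ ∀ a, a ≠ 0 → q₀ a = q₁ a

/-- The `n`-cubes of the degree-`k` structure on the abelian group `A`: the maps whose alternating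
sum vanishes on every `(k+1)`-face. -/
def degreeCubes (k : ℕ) (A : Type z) [AddCommGroup A] (n : ℕ) : Set (Cube n → A) :=
  {q | ∀ φ : Cube (k + 1) → Cube n, IsFaceMap φ →
    ∑ x : Cube (k + 1), (-1 : ℤ) ^ (∑ i, (x i : ℕ)) • q (φ x) = 0}

/-! ## Abelian bundles -/

/-- `B`, with the given action of the abelian group `A` and the bundle map `π`, is an `A`-bundle
over `S`: the action is free, and `s ↦ π⁻¹(s)` is a bijection from `S` to the set of orbits. -/
structure IsAbelianBundle (A : Type z) [AddCommGroup A] {B : Type w} [AddAction A B]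
    {S : Type w} (π : B → S) : Prop where
  free : ∀ (x : B) (a : A), a +ᵥ x = x → a = 0
  fibres : Set.BijOn (fun s : S => π ⁻¹' {s}) Set.univ
    (Set.range fun x : B => AddAction.orbit A x)

/-- The structure of a `k`-fold abelian bundle on the set `X`. The factors are
`B_i = factor i` for `0 ≤ i ≤ k`, and `total` identifies `X` with `B_k`. For `i : Fin k`, that is
`0 ≤ i < k`, `group i` is the structure group `A_{i+1}`, acting on `B_{i+1}`, and `proj i` is the
bundle map `B_{i+1} → B_i`. -/
structure KFoldAbelianBundle (k : ℕ) (X : Type u) where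
  factor : Fin (k + 1) → Type w
  group : Fin k → Type z
  [addCommGroup : ∀ i, AddCommGroup (group i)]
  [addAction : ∀ i, AddAction (group i) (factor i.succ)]
  proj : ∀ i : Fin k, factor i.succ → factor i.castSucc
  total : X ≃ factor (Fin.last k)
  ground_nonempty : Nonempty (factor 0)
  ground_subsingleton : Subsingleton (factor 0)
  isAbelianBundle : ∀ i : Fin k, IsAbelianBundle (group i) (proj i)

attribute [instance] KFoldAbelianBundle.addCommGroup KFoldAbelianBundle.addAction

namespace KFoldAbelianBundle

variable {k : ℕ} {X : Type u}

/-- The projection `π_i : X → B_i`, the composite of the bundle maps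
`X = B_k → B_{k-1} → ⋯ → B_i`. -/
def toFactor (D : KFoldAbelianBundle.{u, w, z} k X) (i : Fin (k + 1)) : X → D.factor i :=
  Fin.reverseInduction (motive := fun i => X → D.factor i) D.total (fun i f => D.proj i ∘ f) i

theorem toFactor_last (D : KFoldAbelianBundle.{u, w, z} k X) :
    D.toFactor (Fin.last k) = D.total := by
  simp [toFactor]

theorem toFactor_castSucc (D : KFoldAbelianBundle.{u, w, z} k X) (i : Fin k) :
    D.toFactor i.castSucc = D.proj i ∘ D.toFactor i.succ := by
  simp [toFactor]

/-- The image cubes `π_i ∘ q` on the factor `B_i`, where `q` is a cube on `X`. -/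
def factorCubes [Cubespace X] (D : KFoldAbelianBundle.{u, w, z} k X) (i : Fin (k + 1)) (n : ℕ) :
    Set (Cube n → D.factor i) :=
  (fun q => D.toFactor i ∘ q) '' Cubespace.cubes (X := X) n

/-- The cubespace `X`, with the `k`-fold abelian bundle structure `D`, is a degree-`k` bundle:
for all `0 ≤ i < k`, the cubes on `B_{i+1}` with the same projection to `B_i` as a given cube `q`
are exactly the translates of `q` by the cubes of the degree-`(i+1)` structure on `A_{i+1}`. -/
def IsDegreeBundle [Cubespace X] (D : KFoldAbelianBundle.{u, w, z} k X) : Prop :=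
  ∀ (i : Fin k) (n : ℕ), ∀ q ∈ D.factorCubes i.succ n,
    {q₂ | q₂ ∈ D.factorCubes i.succ n ∧ D.proj i ∘ q = D.proj i ∘ q₂} =
      {q₂ | ∃ q₃ ∈ degreeCubes ((i : ℕ) + 1) (D.group i) n, q₂ = fun x => q₃ x +ᵥ q x}

/-- The factors of `D` are the characteristic factors of `X`: the map `π_i` induces a bijection
`X/∼_i → B_i` (it is surjective, and its fibres are the classes of `∼_i`). -/
def HasCharacteristicFactors [Nilspace X] (D : KFoldAbelianBundle.{u, w, z} k X) : Prop :=
  ∀ i : Fin (k + 1), Function.Surjective (D.toFactor i) ∧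
    ∀ x y : X, D.toFactor i x = D.toFactor i y ↔ Sim (i : ℕ) x y

end KFoldAbelianBundle

/-- A bundle morphism between `k`-fold abelian bundles: for every `i` the map `ψ` induces a map
`ψ_i : B_i → B'_i`, and there are maps `α_i : A_i → A'_i` with `ψ_i(x + a) = ψ_i(x) + α_i(a)`. -/
structure IsBundleMorphism {k : ℕ} {X : Type u} {X' : Type v}
    (D : KFoldAbelianBundle.{u, w, z} k X) (D' : KFoldAbelianBundle.{v, w', z'} k X')
    (ψ : X → X') : Prop where
  respects : ∀ (i : Fin (k + 1)) (x y : X), D.toFactor i x = D.toFactor i y →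
    D'.toFactor i (ψ x) = D'.toFactor i (ψ y)
  equivariant : ∀ i : Fin k, ∃ (ψi : D.factor i.succ → D'.factor i.succ)
    (αi : D.group i → D'.group i),
    (∀ x : X, ψi (D.toFactor i.succ x) = D'.toFactor i.succ (ψ x)) ∧
    ∀ (b : D.factor i.succ) (a : D.group i), ψi (a +ᵥ b) = αi a +ᵥ ψi b

end Nilspaces

namespace Nilspaces

variable {X : Type u} {ι κ : Type*}

/-! ## Cubes indexed by arbitrary sets -/

/-! Existence. Corner completion extends a map from any lower set of vertices to a cube, as long as
it is a cube on each face in that set (`exists_isCubeMap_extension`). Applied in dimension `2n`,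
this composes the `2^n` cells of a subdivided `n`-cube (`isCubeMap_subdivision`). Hence `x ∼_i y`
holds exactly when the map equal to `y` at one vertex and to `x` elsewhere is an `(i+1)`-cube
(`sim_iff`). It follows that `∼_i` is an equivalence relation, that cubes of dimension at most `i +
1` are insensitive to it (`IsCubeMap.of_sim`), and that `X/∼_i` is an `i`-step nilspace.

In a `(k+1)`-step nilspace, a pair `x ∼_k y` is transported to every other base point by completing
a `(k+2)`-corner. Transport defines a translation, and unique completion makes the translations a
group that is abelian, acts freely, and is transitive on the classes of `∼_k`
(`exists_structureGroup`). Adding group elements along edges moves any shift of a `(k+2)`-cube to a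
single vertex, where only its alternating sum survives; so the cubes over a given cube are its
translates by degree-`(k+1)` cubes (`isCubeMap_vadd_iff`). Doing this for every `X/∼_{i+1}` gives
the bundle.

Morphisms. In any degree-`k` bundle the factors are forced to be the characteristic ones
(`IsDegreeBundle.toFactor_eq_iff`), and morphisms preserve `∼_i`, so the maps `ψ_i` exist. The
relation "`y₀` differs from `x₀` by the same group element as `y₁` from `x₁`" is detected by one
cube (`edgeTip`), and morphisms preserve cubes; hence `α_i` does not depend on the base point
(`IsNilspaceMorphism.structure_unique`), and freeness of the action makes it additive. -/

theorem fin_two_cases (a : Fin 2) : a = 0 ∨ a = 1 := by revert a; decide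

/-- The coordinate description of morphisms of discrete cubes: every coordinate is constant, or
a coordinate of the argument, possibly reflected. -/
def Mor {ι κ : Type*} (g : (ι → Fin 2) → (κ → Fin 2)) : Prop :=
  ∀ k, (∃ c, ∀ x, g x k = c) ∨ ∃ i c, ∀ x, g x k = x i + c

theorem Mor.id : Mor (fun x : ι → Fin 2 => x) := fun k => Or.inr ⟨k, 0, fun x => by simp⟩

theorem Mor.comp {μ : Type*} {g : (ι → Fin 2) → (κ → Fin 2)} {h : (μ → Fin 2) → (ι → Fin 2)}
    (hg : Mor g) (hh : Mor h) : Mor (fun x => g (h x)) := by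
  intro k
  rcases hg k with ⟨c, hc⟩ | ⟨i, c, hc⟩
  · exact Or.inl ⟨c, fun x => hc _⟩
  · rcases hh i with ⟨d, hd⟩ | ⟨j, d, hd⟩
    · exact Or.inl ⟨d + c, fun x => by simp only [hc, hd]⟩
    · exact Or.inr ⟨j, d + c, fun x => by simp only [hc, hd, add_assoc]⟩

theorem Mor.isCubeMorphism {m n : ℕ} {φ : Cube m → Cube n} (h : Mor φ) : IsCubeMorphism φ := by
  have key : ∀ k, ∃ (a : (Fin m → ℤ) →+ ℤ) (t : ℤ), ∀ x : Cube m,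
      ((φ x k : ℕ) : ℤ) = a x.toInt + t := by
    intro k
    rcases h k with ⟨c, hc⟩ | ⟨i, c, hc⟩
    · exact ⟨0, ((c : ℕ) : ℤ), fun x => by simp [hc]⟩
    · rcases fin_two_cases c with rfl | rfl
      · exact ⟨Pi.evalAddMonoidHom _ i, 0, fun x => by simp [hc, Cube.toInt]⟩
      · refine ⟨-Pi.evalAddMonoidHom _ i, 1, fun x => ?_⟩
        rw [hc]
        simp only [Cube.toInt, AddMonoidHom.neg_apply, Pi.evalAddMonoidHom_apply]
        generalize x i = y
        revert y
        decide
  choose a t hat using key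
  exact ⟨AddMonoidHom.pi a, t, fun x => funext fun k => by simpa [Cube.toInt] using hat k x⟩

/-- `f` is a cube, indexed by an arbitrary set of coordinates. -/
def IsCubeMap [Cubespace X] (f : (ι → Fin 2) → X) : Prop :=
  ∀ (n : ℕ) (g : Cube n → (ι → Fin 2)), Mor g → f ∘ g ∈ Cubespace.cubes (X := X) n

theorem isCubeMap_iff [Cubespace X] {n : ℕ} {f : Cube n → X} :
    IsCubeMap f ↔ f ∈ Cubespace.cubes (X := X) n :=
  ⟨fun h => h n _ Mor.id, fun hf _ g hg => Cubespace.comp_mem g hg.isCubeMorphism f hf⟩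

theorem IsCubeMap.comp [Cubespace X] {f : (ι → Fin 2) → X} (hf : IsCubeMap f)
    {g : (κ → Fin 2) → (ι → Fin 2)} (hg : Mor g) : IsCubeMap (fun x => f (g x)) :=
  fun n _ hh => hf n _ (hg.comp hh)

theorem isCubeMap_const [Cubespace X] (x : X) : IsCubeMap (fun _ : ι → Fin 2 => x) := by
  intro n g _
  have h0 : (fun _ : Cube 0 => x) ∈ Cubespace.cubes (X := X) 0 := by
    rw [Cubespace.cubes_zero]; trivial
  exact Cubespace.comp_mem (fun _ : Cube n => (0 : Cube 0))
    (Mor.isCubeMorphism fun k => k.elim0) _ h0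

/-! ### Extension from lower sets of vertices and composition of subdivided cubes. -/

theorem mor_inf (w : ι → Fin 2) : Mor (fun v : ι → Fin 2 => v ⊓ w) := by
  intro k
  rcases fin_two_cases (w k) with h | h
  · refine Or.inl ⟨0, fun x => ?_⟩
    simp only [Pi.inf_apply, h]
    generalize x k = y
    revert y; decide
  · refine Or.inr ⟨k, 0, fun x => ?_⟩
    simp only [Pi.inf_apply, h]
    generalize x k = y
    revert y; decide

theorem fin_two_inf_one (a : Fin 2) : a ⊓ 1 = a := by revert a; decide
theorem fin_two_inf_zero (a : Fin 2) : a ⊓ 0 = 0 := by revert a; decide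
theorem fin_two_le_one (a : Fin 2) : a ≤ 1 := by revert a; decide
theorem fin_two_zero_le (a : Fin 2) : 0 ≤ a := by revert a; decide

theorem fin_two_ne_zero {a : Fin 2} : a ≠ 0 ↔ a = 1 := by revert a; decide
theorem fin_two_ne_one {a : Fin 2} : a ≠ 1 ↔ a = 0 := by revert a; decide

theorem lowerFacet_self {n : ℕ} (i : Fin (n + 1)) (x : Cube n) : lowerFacet i x i = 0 := by
  simp [lowerFacet]

theorem mor_lowerFacet {n : ℕ} (i : Fin (n + 1)) : Mor (lowerFacet i) := by
  intro k
  rcases Fin.eq_self_or_eq_succAbove i k with rfl | ⟨j, rfl⟩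
  · exact Or.inl ⟨0, fun x => lowerFacet_self _ x⟩
  · exact Or.inr ⟨j, 0, fun x => by simp [lowerFacet]⟩

/-- Corner completion on the face `{v | v ≤ w}`. -/
theorem exists_update_isCubeMap [Nilspace X] [Finite ι] (f : (ι → Fin 2) → X) (w : ι → Fin 2)
    [DecidableEq (ι → Fin 2)]
    (hf : ∀ w' < w, IsCubeMap (fun v => f (v ⊓ w'))) :
    ∃ y, IsCubeMap (fun v => Function.update f w y (v ⊓ w)) := by
  classical
  rcases hm : Nat.card {i // w i = 1} with _ | m
  · have hw : w = 0 := by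
      funext i
      by_contra h
      have : Nonempty {i // w i = 1} := ⟨⟨i, fin_two_ne_zero.1 h⟩⟩
      exact Nat.card_pos.ne' hm
    refine ⟨f 0, ?_⟩
    have h2 : (fun v => Function.update f w (f 0) (v ⊓ w)) = fun _ => f 0 := by
      funext v
      have : v ⊓ w = w := by
        funext i; simp [hw]
      rw [this, Function.update_self]
    rw [h2]
    exact isCubeMap_const _
  -- `E` parametrizes the face below `w` and `R` forgets the coordinates where `w` vanishes, so `E ∘
  -- R` is the retraction `v ↦ v ⊓ w`. The corner to be completed is `f ∘ E`.
  · let e : Fin (m + 1) ≃ {i // w i = 1} := (Finite.equivFinOfCardEq hm).symm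
    let E : Cube (m + 1) → (ι → Fin 2) := fun c i =>
      if h : w i = 1 then c (e.symm ⟨i, h⟩) else 0
    let R : (ι → Fin 2) → Cube (m + 1) := fun v j => v (e j)
    have hE : Mor E := by
      intro i
      by_cases h : w i = 1
      · exact Or.inr ⟨e.symm ⟨i, h⟩, 0, fun x => by simp [E, h]⟩
      · exact Or.inl ⟨0, fun x => by simp [E, h]⟩
    have hR : Mor R := fun j => Or.inr ⟨e j, 0, fun x => by simp [R]⟩
    have hER : ∀ v, E (R v) = v ⊓ w := by
      intro v; funext i
      by_cases h : w i = 1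
      · simp [E, R, h, fin_two_inf_one]
      · simp [E, fin_two_ne_one.1 h]
    have hRE : ∀ c, R (E c) = c := by
      intro c; funext j
      simp [R, E, (e j).2]
    have hEle : ∀ c, E c ≤ w := fun c => by
      have h := hER (E c)
      rw [hRE] at h
      rw [h]
      exact inf_le_right
    have hRw : R w = 1 := by funext j; simp [R, (e j).2]
    have hcorner : IsCorner (f ∘ E) := by
      intro j
      -- The lower facet in direction `j` is sent by `E` into the face below this smaller vertex,
      -- where `f` is already a cube.
      let w' : ι → Fin 2 := Function.update w (e j) 0
      have hw' : w' < w := by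
        refine lt_of_le_of_ne ?_ ?_
        · intro i
          by_cases h : i = e j
          · subst h; simp [w']
          · simp [w', h]
        · intro h
          have := congrFun h (e j)
          simp [w', (e j).2] at this
      have h1 := (hf w' hw').comp (hE.comp (mor_lowerFacet j))
      have h2 : ∀ x, E (lowerFacet j x) ⊓ w' = E (lowerFacet j x) := by
        intro x
        refine inf_eq_left.2 fun i => ?_
        by_cases h : i = e j
        · subst h
          simp [w', E, (e j).2, lowerFacet_self]
        · simpa [w', h] using hEle _ i
      simp only [h2] at h1
      exact isCubeMap_iff.1 h1
    obtain ⟨c, hc, hc'⟩ := Nilspace.exists_completion _ hcorner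
    refine ⟨c 1, ?_⟩
    have h3 : (fun v => Function.update f w (c 1) (v ⊓ w)) = fun v => c (R v) := by
      funext v
      by_cases h : R v = 1
      · have : v ⊓ w = w := by
          rw [← hER, h, ← hRw, hER, inf_idem]
        rw [this, h, Function.update_self]
      · have : v ⊓ w ≠ w := by
          intro h'
          apply h
          rw [← hRE (R v), hER, h', hRw]
        rw [Function.update_of_ne this, hc' _ h, Function.comp, hER]
    rw [h3]
    exact (isCubeMap_iff.2 hc).comp hR

/-- A map on a lower set of vertices that is a cube on every face in this set extends to a
cube. -/
theorem exists_isCubeMap_extension [Nilspace X] [Finite ι] (P : Set (ι → Fin 2))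
    (hP : IsLowerSet P) (f : (ι → Fin 2) → X)
    (hf : ∀ w ∈ P, IsCubeMap (fun v => f (v ⊓ w))) :
    ∃ Q : (ι → Fin 2) → X, IsCubeMap Q ∧ ∀ v ∈ P, Q v = f v := by
  classical
  induction hN : Pᶜ.ncard generalizing P f with
  | zero =>
    have hPc : Pᶜ = ∅ := (Set.ncard_eq_zero (Set.toFinite _)).1 hN
    have hPu : P = Set.univ := Set.compl_empty_iff.1 hPc
    refine ⟨f, ?_, fun v _ => rfl⟩
    have := hf 1 (by rw [hPu]; trivial)
    have h1 : ∀ v : ι → Fin 2, v ⊓ 1 = v := fun v => by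
      funext i; simp [fin_two_inf_one]
    simpa only [h1] using this
  | succ N ih =>
    have hne : Pᶜ.Nonempty := by
      rw [← Set.ncard_pos (Set.toFinite _)]; omega
    -- Everything strictly below a minimal missing vertex lies in `P`, so the value at that vertex
    -- comes from completing one corner.
    obtain ⟨w, hw⟩ := (Set.toFinite Pᶜ).exists_minimal hne
    have hlt : ∀ w' < w, w' ∈ P := by
      intro w' hw'
      by_contra h
      exact not_le_of_gt hw' (hw.2 h hw'.le)
    have hwP : w ∉ P := hw.1
    obtain ⟨y, hy⟩ := exists_update_isCubeMap f w fun w' hw' => hf w' (hlt w' hw')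
    have hlower : IsLowerSet (insert w P) := by
      intro a b hab ha
      rcases ha with rfl | ha
      · rcases hab.eq_or_lt with h | h
        · exact Or.inl h
        · exact Or.inr (hlt _ h)
      · exact Or.inr (hP hab ha)
    have hfaces : ∀ w' ∈ insert w P,
        IsCubeMap (fun v => Function.update f w y (v ⊓ w')) := by
      intro w' hw'
      rcases hw' with rfl | hw'
      · exact hy
      · have : (fun v => Function.update f w y (v ⊓ w')) = fun v => f (v ⊓ w') := by
          funext v
          rw [Function.update_of_ne]
          intro h
          exact hwP (h ▸ hP inf_le_right hw')
        rw [this]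
        exact hf w' hw'
    have hcard : (insert w P)ᶜ.ncard = N := by
      have : (insert w P)ᶜ = Pᶜ \ {w} := by
        ext x; simp [not_or, and_comm]
      rw [this, Set.ncard_sdiff_singleton_of_mem hw.1, hN]; rfl
    obtain ⟨Q, hQ, hQ'⟩ := ih _ hlower _ hfaces hcard
    refine ⟨Q, hQ, fun v hv => ?_⟩
    rw [hQ' v (Set.mem_insert_of_mem _ hv), Function.update_of_ne]
    rintro rfl; exact hwP hv

/-- Composition of the `2^n` cubes of a subdivided cube: the pairs `(a, b)` with `a ⊓ b = 0`
parametrize the points `1 + a - b` of `{0,1,2}^n`. -/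
theorem isCubeMap_subdivision [Nilspace X] [Finite ι] (F : (ι → Fin 2) → (ι → Fin 2) → X)
    (hF : ∀ w : ι → Fin 2, IsCubeMap (fun u => F (u ⊓ w) (u ⊓ (w + 1)))) :
    IsCubeMap (fun v => F v (v + 1)) := by
  have dec1 : ∀ a b c d : Fin 2, b ⊓ d = 0 →
      (((a ⊓ b) ⊔ (c ⊓ d)) ⊓ b = a ⊓ b ∧ ((a ⊓ b) ⊔ (c ⊓ d)) ⊓ (b + 1) = c ⊓ d) := by decide
  have dec2 : ∀ a b c d : Fin 2, a ≤ b → c ≤ d → b ⊓ d = 0 → a ⊓ c = 0 := by decide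
  have dec3 : ∀ a : Fin 2, a ⊓ (a + 1) = 0 := by decide
  have dec4 : ∀ a c : Fin 2, (a ⊓ 1) ⊔ (c ⊓ 0) = a + 0 ∧ (a ⊓ 0) ⊔ (c ⊓ 1) = c + 0 ∧
      (a ⊓ 0) ⊔ (c ⊓ 0) = 0 := by decide
  -- The pairs `(a, b)` with `a ⊓ b = 0` form a lower set in the `2n`-cube. Its maximal faces lie
  -- below the vertices `(w, w + 1)` and are the cells of the subdivision, all meeting at the centre
  -- `(0, 0)`.
  obtain ⟨Q, hQ, hQ'⟩ := exists_isCubeMap_extension (ι := ι ⊕ ι)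
    {z | ∀ i, z (Sum.inl i) ⊓ z (Sum.inr i) = 0}
    (fun a b hab ha i => dec2 _ _ _ _ (hab _) (hab _) (ha i))
    (fun z => F (fun i => z (Sum.inl i)) (fun i => z (Sum.inr i)))
    (by
      intro w hw
      let u : (ι ⊕ ι → Fin 2) → (ι → Fin 2) := fun z i =>
        (z (Sum.inl i) ⊓ w (Sum.inl i)) ⊔ (z (Sum.inr i) ⊓ w (Sum.inr i))
      have hu : Mor u := by
        intro i
        have hi := hw i
        rcases fin_two_cases (w (Sum.inl i)) with h | h <;>
        rcases fin_two_cases (w (Sum.inr i)) with h' | h'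
        · exact Or.inl ⟨0, fun x => by simp only [u, h, h']; exact (dec4 _ _).2.2⟩
        · exact Or.inr ⟨Sum.inr i, 0, fun x => by simp only [u, h, h']; exact (dec4 _ _).2.1⟩
        · exact Or.inr ⟨Sum.inl i, 0, fun x => by simp only [u, h, h']; exact (dec4 _ _).1⟩
        · rw [h, h'] at hi; exact absurd hi (by decide)
      have := (hF fun i => w (Sum.inl i)).comp hu
      convert this using 3 with z
      · funext i; exact (dec1 _ _ _ _ (hw i)).1.symm
      · funext i; exact (dec1 _ _ _ _ (hw i)).2.symm)
  -- The outer cube consists of the points `(v, v + 1)`; these are the values of a morphism into the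
  -- `2n`-cube and lie in the lower set.
  have := hQ.comp (g := fun (v : ι → Fin 2) => (Sum.elim v (v + 1) : ι ⊕ ι → Fin 2)) (by
    rintro (i | i)
    · exact Or.inr ⟨i, 0, fun x => by simp⟩
    · exact Or.inr ⟨i, 1, fun x => by simp⟩)
  convert this using 2 with v
  rw [hQ' _ (fun i => dec3 _)]
  rfl

/-! ## The relations `∼_i` -/

theorem mor_add (w : ι → Fin 2) : Mor (fun v : ι → Fin 2 => v + w) :=
  fun k => Or.inr ⟨k, w k, fun _ => rfl⟩

theorem add_add_self (v w : ι → Fin 2) : v + w + w = v := by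
  have : ∀ a b : Fin 2, a + b + b = a := by decide
  funext i; exact this _ _

theorem one_add_add_one (w : ι → Fin 2) : 1 + (w + 1) = w := by
  have : ∀ a : Fin 2, 1 + (a + 1) = a := by decide
  funext i; exact this _

theorem add_add_one_eq_one_iff {v w : ι → Fin 2} : v + (w + 1) = 1 ↔ v = w := by
  have : ∀ a b : Fin 2, a + (b + 1) = 1 ↔ a = b := by decide
  simp only [funext_iff]
  exact forall_congr' fun i => this _ _

theorem inf_one_eq (v : ι → Fin 2) : v ⊓ 1 = v := by
  funext i; exact fin_two_inf_one _

theorem inf_zero_eq (v : ι → Fin 2) : v ⊓ 0 = 0 := by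
  funext i; exact fin_two_inf_zero _

theorem one_add_one_eq : (1 + 1 : ι → Fin 2) = 0 := by
  funext i; rfl

theorem le_one_cube (v : ι → Fin 2) : v ≤ 1 := fun _ => fin_two_le_one _

theorem inf_eq_one_iff {v w : ι → Fin 2} : v ⊓ w = 1 ↔ v = 1 ∧ w = 1 := by
  refine ⟨fun h => ⟨le_antisymm (le_one_cube _) (h ▸ inf_le_left),
    le_antisymm (le_one_cube _) (h ▸ inf_le_right)⟩, ?_⟩
  rintro ⟨rfl, rfl⟩
  exact inf_idem _

open Classical in
/-- The map with value `y` at the vertex `1` and value `x` at all other vertices. -/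
noncomputable def tip (x y : X) : (ι → Fin 2) → X := fun v => if v = 1 then y else x

theorem tip_one (x y : X) : (tip x y : (ι → Fin 2) → X) 1 = y := if_pos rfl

theorem tip_of_ne (x y : X) {v : ι → Fin 2} (h : v ≠ 1) : tip x y v = x := if_neg h

theorem tip_self (x : X) : (tip x x : (ι → Fin 2) → X) = fun _ => x := by
  funext v; simp [tip]

theorem comp_tip {Y : Type v} (f : X → Y) (x y : X) :
    f ∘ (tip x y : (ι → Fin 2) → X) = tip (f x) (f y) := by
  funext v
  by_cases h : v = 1 <;> simp [tip, h]

-- Glue the tip cube to `q` at the vertex `1`: it fills the cell `w = 1`, and each other cell is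
-- filled by a collapsed copy of `q`.
open Classical in
theorem IsCubeMap.update_one [Nilspace X] [Finite ι] {q : (ι → Fin 2) → X} (hq : IsCubeMap q)
    {y : X} (h : IsCubeMap (tip (q 1) y : (ι → Fin 2) → X)) :
    IsCubeMap (Function.update q 1 y) := by
  have := isCubeMap_subdivision (fun a b : ι → Fin 2 => if a = 1 then y else q (b + 1)) (by
    intro w
    by_cases hw : w = 1
    · subst hw
      convert h using 2 with u
      simp [inf_one_eq, one_add_one_eq, inf_zero_eq, tip]
    · have h2 := hq.comp ((mor_add 1).comp (mor_inf (w + 1)))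
      convert h2 using 2 with u
      rw [if_neg fun h => hw (inf_eq_one_iff.1 h).2])
  convert this using 2 with v
  simp [Function.update_apply, add_add_self]

-- Fill every cell with `q₀` reflected about the centre, except the cell `w = 1`, which gets `q₁`.
-- The cells agree on common faces, and all outer vertices but one carry `q₀ 1`.
open Classical in
theorem isCubeMap_tip_of_eq [Nilspace X] [Finite ι] {q₀ q₁ : (ι → Fin 2) → X}
    (h₀ : IsCubeMap q₀) (h₁ : IsCubeMap q₁) (h : ∀ v, v ≠ 1 → q₀ v = q₁ v) :
    IsCubeMap (tip (q₀ 1) (q₁ 1) : (ι → Fin 2) → X) := by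
  have e1 : ∀ a b : Fin 2, (a ⊓ b) ⊔ (a ⊓ (b + 1)) = a := by decide
  have e2 : ∀ a : Fin 2, a ⊔ (a + 1) = 1 := by decide
  have e3 : ∀ a : Fin 2, a ⊔ 0 = a := by decide
  have := isCubeMap_subdivision (fun a b : ι → Fin 2 => if a = 1 then q₁ 1 else q₀ (a ⊔ b)) (by
    intro w
    by_cases hw : w = 1
    · subst hw
      convert h₁ using 2 with u
      have h3 : u ⊔ 0 = u := funext fun i => e3 _
      simp only [inf_one_eq, one_add_one_eq, inf_zero_eq, h3]
      split_ifs with hu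
      · rw [hu]
      · exact h u hu
    · convert h₀ using 2 with u
      rw [if_neg fun h => hw (inf_eq_one_iff.1 h).2]
      congr 1
      funext i; exact e1 _ _)
  convert this using 2 with v
  have h3 : v ⊔ (v + 1) = 1 := funext fun i => e2 _
  simp only [h3, tip]

/-- Replaces two unspecified cubes by one explicit cube, which restricts well to faces and commutes
with maps. The reflection `v ↦ v + 1` moves the special vertex from `0` to `1`. -/
theorem sim_iff [Nilspace X] {i : ℕ} {x y : X} :
    Sim i x y ↔ IsCubeMap (tip x y : Cube (i + 1) → X) := by
  constructor
  · rintro ⟨q₀, h₀, q₁, h₁, rfl, rfl, h⟩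
    have key := isCubeMap_tip_of_eq ((isCubeMap_iff.2 h₀).comp (mor_add 1))
      ((isCubeMap_iff.2 h₁).comp (mor_add 1)) (fun v hv => h _ fun h' => hv (by
        rw [← add_add_self v 1, h', zero_add]))
    simpa only [one_add_one_eq] using key
  · intro h
    refine ⟨_, isCubeMap_iff.1 (isCubeMap_const x), _, isCubeMap_iff.1 (h.comp (mor_add 1)),
      rfl, ?_, fun a ha => ?_⟩
    · simp only [zero_add, tip_one]
    · refine (tip_of_ne _ _ fun h' => ha ?_).symm
      rw [← add_add_self a 1, h', one_add_one_eq]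

theorem Sim.refl [Nilspace X] (i : ℕ) (x : X) : Sim i x x :=
  sim_iff.2 (by rw [tip_self]; exact isCubeMap_const x)

theorem Sim.symm [Nilspace X] {i : ℕ} {x y : X} (h : Sim i x y) : Sim i y x := by
  obtain ⟨q₀, h₀, q₁, h₁, hx, hy, h⟩ := h
  exact ⟨q₁, h₁, q₀, h₀, hy, hx, fun a ha => (h a ha).symm⟩

theorem Sim.trans [Nilspace X] {i : ℕ} {x y z : X} (h : Sim i x y) (h' : Sim i y z) :
    Sim i x z := by
  rw [sim_iff] at *
  have := h.update_one (y := z) (by rwa [tip_one])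
  convert this using 2
  funext v
  by_cases hv : v = 1 <;> simp [tip, hv]

/-- The equivalence relation `∼_i`. -/
def simSetoid (X : Type u) [Nilspace X] (i : ℕ) : Setoid X :=
  ⟨Sim i, Sim.refl i, Sim.symm, Sim.trans⟩

/-! ### Faces -/

/-- The parametrization of a face with top vertex `w` whose free coordinates are given by `e`. -/
noncomputable def faceEmb {κ : Type*} (e : κ → ι) (w : ι → Fin 2) (c : κ → Fin 2) :
    ι → Fin 2 :=
  Function.extend e c w

theorem faceEmb_apply {e : κ → ι} (he : Function.Injective e) {w : ι → Fin 2}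
    (c : κ → Fin 2) (j : κ) : faceEmb e w c (e j) = c j :=
  he.extend_apply _ _ _

theorem faceEmb_apply' {e : κ → ι} {w : ι → Fin 2} (c : κ → Fin 2) {a : ι}
    (ha : a ∉ Set.range e) : faceEmb e w c a = w a :=
  Function.extend_apply' _ _ _ ha

theorem mor_faceEmb {e : κ → ι} (he : Function.Injective e) {w : ι → Fin 2} :
    Mor (faceEmb e w) := by
  intro a
  by_cases ha : a ∈ Set.range e
  · obtain ⟨j, rfl⟩ := ha
    exact Or.inr ⟨j, 0, fun x => by simp [faceEmb_apply he]⟩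
  · exact Or.inl ⟨w a, fun x => faceEmb_apply' x ha⟩

theorem faceEmb_one {e : κ → ι} (he : Function.Injective e) {w : ι → Fin 2}
    (hw : ∀ j, w (e j) = 1) : faceEmb e w 1 = w := by
  funext a
  by_cases ha : a ∈ Set.range e
  · obtain ⟨j, rfl⟩ := ha
    rw [faceEmb_apply he, hw]; rfl
  · exact faceEmb_apply' _ ha

theorem faceEmb_injective {e : κ → ι} (he : Function.Injective e) {w : ι → Fin 2} :
    Function.Injective (faceEmb e w) := by
  intro c d h
  funext j
  rw [← faceEmb_apply he c j, h, faceEmb_apply he]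

theorem faceEmb_le {e : κ → ι} {w : ι → Fin 2} (hw : ∀ j, w (e j) = 1) (c : κ → Fin 2) : faceEmb e w c ≤ w := by
  intro a
  by_cases ha : a ∈ Set.range e
  · obtain ⟨j, rfl⟩ := ha
    rw [hw]; exact fin_two_le_one _
  · rw [faceEmb_apply' _ ha]

theorem faceEmb_lt {e : κ → ι} (he : Function.Injective e) {w : ι → Fin 2}
    (hw : ∀ j, w (e j) = 1) {c : κ → Fin 2} (hc : c ≠ 1) : faceEmb e w c < w :=
  lt_of_le_of_ne (faceEmb_le hw c) fun h =>
    hc (faceEmb_injective he (w := w) (by rw [h, faceEmb_one he hw]))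

theorem isFaceMap_faceEmb {m n : ℕ} {e : Fin m → Fin n} (he : Function.Injective e)
    (w : Cube n) : IsFaceMap (faceEmb e w : Cube m → Cube n) := by
  classical
  refine ⟨(mor_faceEmb he).isCubeMorphism, faceEmb_injective he,
    (Finset.univ.image e)ᶜ, w, ?_, ?_⟩
  · rw [Finset.card_compl, Finset.card_image_of_injective _ he, Finset.card_univ,
      Fintype.card_fin, Fintype.card_fin]
    have := Fintype.card_le_of_injective e he
    simp only [Fintype.card_fin] at this
    omega
  · ext x
    constructor
    · rintro ⟨c, rfl⟩ i hi
      exact faceEmb_apply' _ (by simpa using hi)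
    · intro hx
      refine ⟨fun j => x (e j), ?_⟩
      funext a
      by_cases ha : a ∈ Set.range e
      · obtain ⟨j, rfl⟩ := ha
        rw [faceEmb_apply he]
      · rw [faceEmb_apply' _ ha]
        exact (hx a (by simpa using ha)).symm

/-- The number of coordinates of a vertex that are equal to `1`. -/
noncomputable def weight (w : ι → Fin 2) : ℕ := Nat.card {a // w a = 1}

theorem weight_one : weight (1 : ι → Fin 2) = Nat.card ι :=
  Nat.card_congr (Equiv.subtypeUnivEquiv fun _ => rfl)

theorem weight_mono [Finite ι] {v w : ι → Fin 2} (h : v ≤ w) : weight v ≤ weight w :=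
  Nat.card_le_card_of_injective
    (fun a : {a // v a = 1} => (⟨a.1, le_antisymm (fin_two_le_one _) (a.2.symm.le.trans (h a.1))⟩ :
      {a // w a = 1}))
    (fun _ _ hab => Subtype.ext (Subtype.mk.inj hab))

theorem exists_injective_of_le_weight [Finite ι] {m : ℕ} {w : ι → Fin 2} (h : m ≤ weight w) :
    ∃ e : Fin m → ι, Function.Injective e ∧ ∀ j, w (e j) = 1 := by
  let e : Fin (weight w) ≃ {a // w a = 1} := (Finite.equivFin _).symm
  exact ⟨fun j => e (Fin.castLE h j), fun a b hab =>
    Fin.castLE_injective h (e.injective (Subtype.ext hab)), fun j => (e _).2⟩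

/-! ### Replacing values -/

open Classical in
theorem IsCubeMap.update_of_sim [Nilspace X] {i : ℕ} {q : Cube (i + 1) → X} (hq : IsCubeMap q)
    {w : Cube (i + 1)} {y : X} (h : Sim i (q w) y) : IsCubeMap (Function.update q w y) := by
  have h1 := hq.comp (mor_add (w + 1))
  have h2 := h1.update_one (y := y) (by
    simp only [one_add_add_one]
    exact sim_iff.1 h)
  have h3 := h2.comp (mor_add (w + 1))
  convert h3 using 2 with v
  simp only [Function.update_apply, add_add_self]
  simp only [add_add_one_eq_one_iff]

open Classical in
theorem IsCubeMap.of_sim_aux [Nilspace X] {i : ℕ} {q q' : Cube (i + 1) → X} (hq : IsCubeMap q)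
    (h : ∀ v, Sim i (q v) (q' v)) : IsCubeMap q' := by
  have key : ∀ S : Finset (Cube (i + 1)), IsCubeMap (fun v => if v ∈ S then q' v else q v) := by
    intro S
    induction S using Finset.induction_on with
    | empty => simpa using hq
    | insert w S hw ih =>
      have := ih.update_of_sim (w := w) (y := q' w) (by simpa [hw] using h w)
      convert this using 2 with v
      by_cases hv : v = w
      · subst hv; simp
      · simp [hv]
  simpa using key Finset.univ

/-- The cubes of dimension at most `i + 1` are unions of classes of `∼_i`. -/
theorem IsCubeMap.of_sim [Nilspace X] [Finite ι] {i : ℕ} (hi : Nat.card ι ≤ i + 1)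
    {q q' : (ι → Fin 2) → X} (hq : IsCubeMap q) (h : ∀ v, Sim i (q v) (q' v)) :
    IsCubeMap q' := by
  let e : ι → Fin (i + 1) := fun a => Fin.castLE hi (Finite.equivFin ι a)
  have he : Function.Injective e := fun a b hab =>
    (Finite.equivFin ι).injective (Fin.castLE_injective hi hab)
  have hg : Mor (fun (c : Cube (i + 1)) (a : ι) => c (e a)) :=
    fun a => Or.inr ⟨e a, 0, fun x => by simp⟩
  have h1 := (hq.comp hg).of_sim_aux (q' := fun c => q' fun a => c (e a)) fun c => h _
  have h2 := h1.comp (mor_faceEmb he (w := 0))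
  convert h2 using 2 with v
  congr 1
  funext a
  rw [faceEmb_apply he]

theorem IsCubeMap.of_sim_face [Nilspace X] [Finite ι] {i : ℕ} {w : ι → Fin 2}
    (hw : weight w ≤ i + 1) {q q' : (ι → Fin 2) → X} (hq : IsCubeMap q)
    (h : ∀ v ≤ w, Sim i (q v) (q' v)) : IsCubeMap (fun v => q' (v ⊓ w)) := by
  classical
  let e : {a // w a = 1} → ι := Subtype.val
  have he : Function.Injective e := Subtype.val_injective
  have hw1 : ∀ j, w (e j) = 1 := fun j => j.2
  have h1 := (hq.comp (mor_faceEmb he (w := w))).of_sim hw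
    (q' := fun c => q' (faceEmb e w c)) fun c => h _ (faceEmb_le hw1 c)
  have hR : Mor (fun (v : ι → Fin 2) (j : {a // w a = 1}) => v (e j)) :=
    fun j => Or.inr ⟨e j, 0, fun x => by simp⟩
  convert h1.comp hR using 2 with v
  congr 1
  funext a
  by_cases ha : w a = 1
  · rw [Pi.inf_apply, ha, fin_two_inf_one]
    exact (faceEmb_apply he (fun j => v (e j)) ⟨a, ha⟩).symm
  · rw [faceEmb_apply', Pi.inf_apply, fin_two_ne_one.1 ha, fin_two_inf_zero]
    rintro ⟨j, rfl⟩
    exact ha j.2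

/-- Uniqueness of completions modulo `∼_i` on faces of dimension at least `i + 1`. -/
theorem IsCubeMap.sim_top [Nilspace X] [Finite ι] {i : ℕ} {w : ι → Fin 2}
    (hw : i + 1 ≤ weight w) {q q' : (ι → Fin 2) → X} (hq : IsCubeMap q) (hq' : IsCubeMap q')
    (h : ∀ v < w, Sim i (q v) (q' v)) : Sim i (q w) (q' w) := by
  classical
  obtain ⟨e, he, hw1⟩ := exists_injective_of_le_weight hw
  have h0 := hq.comp (mor_faceEmb he (w := w))
  have h1 := hq'.comp (mor_faceEmb he (w := w))
  -- On an `(i+1)`-face with top `w`, the values of `q'` below the top may be replaced by those of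
  -- `q`. The resulting cube differs from `q` at the top only, so the two top values are related.
  have h2 := h1.of_sim (i := i) (by simp)
    (q' := Function.update (fun c => q (faceEmb e w c)) 1 (q' w)) (fun c => by
      by_cases hc : c = 1
      · subst hc
        rw [Function.update_self, faceEmb_one he hw1]
        exact Sim.refl _ _
      · rw [Function.update_of_ne hc]
        exact (h _ (faceEmb_lt he hw1 hc)).symm)
  have h3 := isCubeMap_tip_of_eq h0 h2 (fun v hv => by rw [Function.update_of_ne hv])
  rw [Function.update_self, faceEmb_one he hw1] at h3
  exact sim_iff.2 h3

theorem Sim.mono [Nilspace X] {i j : ℕ} (hij : j ≤ i) {x y : X} (h : Sim i x y) :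
    Sim j x y := by
  rw [sim_iff] at *
  obtain ⟨e, he, hw1⟩ := exists_injective_of_le_weight (w := (1 : Cube (i + 1))) (m := j + 1)
    (by rw [weight_one]; simpa using hij)
  have h2 := h.comp (mor_faceEmb he (w := 1))
  convert h2 using 2 with v
  by_cases hv : v = 1
  · subst hv
    rw [faceEmb_one he hw1, tip_one, tip_one]
  · rw [tip_of_ne _ _ hv, tip_of_ne _ _ (faceEmb_lt he hw1 hv).ne]

/-! ## The characteristic factors -/

/-- The characteristic factor `X/∼_i`. -/
abbrev CharFactor (X : Type u) [Nilspace X] (i : ℕ) : Type u := Quotient (simSetoid X i)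

namespace CharFactor

/-- The quotient map onto the characteristic factor. -/
def mk [Nilspace X] (i : ℕ) (x : X) : CharFactor X i := Quotient.mk _ x

theorem mk_eq_iff [Nilspace X] {i : ℕ} {x y : X} : mk i x = mk i y ↔ Sim i x y :=
  Quotient.eq (r := simSetoid X i)

theorem mk_surjective [Nilspace X] (i : ℕ) : Function.Surjective (mk (X := X) i) :=
  Quotient.mk_surjective

instance [Nilspace X] (i : ℕ) : Cubespace (CharFactor X i) where
  cubes n := (fun q => mk i ∘ q) '' Cubespace.cubes (X := X) n
  comp_mem := by
    rintro m n φ hφ _ ⟨q, hq, rfl⟩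
    exact ⟨q ∘ φ, Cubespace.comp_mem φ hφ q hq, rfl⟩
  cubes_zero := by
    refine Set.eq_univ_of_forall fun q => ?_
    obtain ⟨f, rfl⟩ := (mk_surjective (X := X) i).comp_left q
    exact ⟨f, by rw [Cubespace.cubes_zero]; trivial, rfl⟩

/-- The lifts of the facets to `X` need not agree on overlaps. An arbitrary pointwise lift is
nevertheless a cube on faces of dimension at most `i + 1`, so its restriction to those faces extends
to a cube of `X`. At the vertices of larger weight other than `1`, `IsCubeMap.sim_top` forces the
projection to agree with the given corner. -/
theorem exists_completion [Nilspace X] {i n : ℕ} (q : Cube (n + 1) → CharFactor X i)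
    (hq : IsCorner q) : ∃ c, IsCompletion q c := by
  have hlift : ∀ w : Cube (n + 1), w ≠ 1 → ∃ r : Cube (n + 1) → X, IsCubeMap r ∧
      ∀ v ≤ w, mk i (r v) = q v := by
    intro w hw
    obtain ⟨j, hj⟩ : ∃ j, w j = 0 := by
      by_contra! h
      exact hw (funext fun j => fin_two_ne_zero.1 (h j))
    obtain ⟨r, hr, hr'⟩ := hq j
    refine ⟨fun v => r fun a => v (j.succAbove a), (isCubeMap_iff.2 hr).comp
      (fun a => Or.inr ⟨j.succAbove a, 0, fun x => by simp⟩), fun v hv => ?_⟩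
    have hvj : v j = 0 := le_antisymm (hj ▸ hv j) (fin_two_zero_le _)
    have hv' : lowerFacet j (fun a => v (j.succAbove a)) = v := by
      funext b
      rcases Fin.eq_self_or_eq_succAbove j b with rfl | ⟨c, rfl⟩
      · rw [lowerFacet_self, hvj]
      · simp [lowerFacet]
    have := congrFun hr' fun a => v (j.succAbove a)
    simpa [hv'] using this
  obtain ⟨f, rfl⟩ := (mk_surjective (X := X) i).comp_left q
  obtain ⟨Q, hQ, hQ'⟩ := exists_isCubeMap_extension
    {v : Cube (n + 1) | v ≠ 1 ∧ weight v ≤ i + 1}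
    (fun a b hab ha => ⟨fun hb => ha.1 (le_antisymm (le_one_cube _) (hb ▸ hab)),
      (weight_mono hab).trans ha.2⟩) f
    (fun w hw => by
      obtain ⟨r, hr, hr'⟩ := hlift w hw.1
      exact hr.of_sim_face hw.2 fun v hv => mk_eq_iff.1 (hr' v hv))
  refine ⟨mk i ∘ Q, ⟨Q, isCubeMap_iff.1 hQ, rfl⟩, ?_⟩
  intro w
  induction w using WellFoundedLT.induction with
  | ind w ih =>
  intro hw
  by_cases hc : weight w ≤ i + 1
  · exact congrArg (mk i) (hQ' w ⟨hw, hc⟩)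
  · obtain ⟨r, hr, hr'⟩ := hlift w hw
    have := hQ.sim_top (by omega : i + 1 ≤ weight w) hr fun v hv => mk_eq_iff.1 (by
      rw [hr' v hv.le]
      exact ih v hv fun h => absurd hv (h ▸ (not_lt_of_ge (le_one_cube _))))
    exact (mk_eq_iff.2 this).trans (hr' w le_rfl)

instance [Nilspace X] (i : ℕ) : Nilspace (CharFactor X i) where
  ergodic := by
    refine Set.eq_univ_of_forall fun q => ?_
    obtain ⟨f, rfl⟩ := (mk_surjective (X := X) i).comp_left q
    exact ⟨f, by rw [Nilspace.ergodic]; trivial, rfl⟩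
  exists_completion := exists_completion

theorem isStep [Nilspace X] (i : ℕ) : IsStep i (CharFactor X i) := by
  intro q hq
  obtain ⟨c, hc⟩ := Nilspace.exists_completion q hq
  refine ⟨c, hc, ?_⟩
  rintro c' hc'
  obtain ⟨r, hr, rfl⟩ := hc.1
  obtain ⟨r', hr', rfl⟩ := hc'.1
  funext v
  by_cases hv : v = 1
  · subst hv
    refine mk_eq_iff.2 ((isCubeMap_iff.2 hr').sim_top (by rw [weight_one]; simp)
      (isCubeMap_iff.2 hr) fun v hv => mk_eq_iff.1 ?_)
    exact (hc'.2 v hv.ne).trans (hc.2 v hv.ne).symm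
  · exact (hc'.2 v hv).trans (hc.2 v hv).symm

/-- The witnessing tip cube has dimension `j + 1 ≤ i + 1`, so any lift of it can be changed within
classes of `∼_i`. -/
theorem sim_mk_iff [Nilspace X] {i j : ℕ} (hij : j ≤ i) {x y : X} :
    Sim j (mk i x) (mk i y) ↔ Sim j x y := by
  rw [sim_iff, sim_iff, isCubeMap_iff, isCubeMap_iff]
  constructor
  · rintro ⟨r, hr, hr'⟩
    refine isCubeMap_iff.1 ((isCubeMap_iff.2 hr).of_sim (i := i) (by simpa using hij)
      fun v => mk_eq_iff.1 ?_)
    rw [← comp_tip] at hr'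
    exact congrFun hr' v
  · intro h
    exact ⟨_, h, comp_tip _ _ _⟩

end CharFactor

theorem IsStep.unique [Nilspace X] {k : ℕ} (hX : IsStep k X) {q q' : Cube (k + 1) → X}
    (hq : IsCubeMap q) (hq' : IsCubeMap q') (h : ∀ v, v ≠ 1 → q v = q' v) : q = q' := by
  have hc : IsCorner q := fun i => isCubeMap_iff.1 (hq.comp (mor_lowerFacet i))
  exact (hX q hc).unique ⟨isCubeMap_iff.1 hq, fun _ _ => rfl⟩
    ⟨isCubeMap_iff.1 hq', fun x hx => (h x hx).symm⟩

theorem IsStep.eq_of_sim [Nilspace X] {k : ℕ} (hX : IsStep k X) {x y : X} (h : Sim k x y) :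
    x = y := by
  have := hX.unique (sim_iff.1 h) (isCubeMap_const x) fun v hv => tip_of_ne _ _ hv
  simpa [tip_one] using (congrFun this 1).symm

/-! ## Translations -/

open Classical in
/-- The map that equals `y` and `y'` at the two vertices of the edge in direction `j` through the
vertex `1`, and otherwise takes the values `x` and `x'` according to the coordinate `j`. -/
noncomputable def edgeTip (j : ι) (x y x' y' : X) : (ι → Fin 2) → X := fun v =>
  if ∀ i, i ≠ j → v i = 1 then (if v j = 0 then y else y') else (if v j = 0 then x else x')

theorem edgeTip_one (j : ι) (x y x' y' : X) : edgeTip j x y x' y' 1 = y' := by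
  simp [edgeTip]

theorem comp_edgeTip {Y : Type v} (f : X → Y) (j : ι) (x y x' y' : X) :
    f ∘ edgeTip j x y x' y' = edgeTip j (f x) (f y) (f x') (f y') := by
  funext v
  simp only [edgeTip, Function.comp]
  split_ifs <;> rfl

theorem IsCubeMap.edgeTip_swap [Cubespace X] {j : ι} {x y x' y' : X}
    (h : IsCubeMap (edgeTip j x y x' y')) (j' : ι) : IsCubeMap (edgeTip j' x y x' y') := by
  classical
  have hg : Mor (fun (v : ι → Fin 2) i => v (Equiv.swap j j' i)) :=
    fun i => Or.inr ⟨Equiv.swap j j' i, 0, fun x => by simp⟩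
  convert h.comp hg using 2 with v
  have : (∀ i, i ≠ j → v (Equiv.swap j j' i) = 1) ↔ ∀ i, i ≠ j' → v i = 1 := by
    rw [← (Equiv.swap j j').forall_congr_right]
    refine forall_congr' fun i => ?_
    rw [Equiv.swap_apply_self, ne_eq, Equiv.swap_apply_eq_iff, Equiv.swap_apply_left]
  simp only [edgeTip, Equiv.swap_apply_left, this]

theorem isCubeMap_edge [Nilspace X] (j : ι) (x x' : X) :
    IsCubeMap (fun v : ι → Fin 2 => if v j = 0 then x else x') := by
  have h1 : IsCubeMap (fun c : Cube 1 => if c 0 = 0 then x else x') :=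
    isCubeMap_iff.2 (by rw [Nilspace.ergodic]; trivial)
  exact h1.comp (g := fun (v : ι → Fin 2) _ => v j) fun _ => Or.inr ⟨j, 0, fun x => by simp⟩

theorem edgeTip_zero_cons {n : ℕ} (x y x' y' : X) (a : Fin 2) (c : Cube n) :
    edgeTip 0 x y x' y' (Fin.cons a c : Cube (n + 1)) =
      if a = 0 then tip x y c else tip x' y' c := by
  have : (∀ i : Fin (n + 1), i ≠ 0 → (Fin.cons a c : Cube (n + 1)) i = 1) ↔ c = 1 := by
    rw [Fin.forall_fin_succ, funext_iff]
    simp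
  simp only [edgeTip, this, tip, Fin.cons_zero]
  split_ifs <;> rfl

theorem mor_cons {n : ℕ} (a : Fin 2) :
    Mor (fun c : Cube n => (Fin.cons a c : Cube (n + 1))) := by
  intro i
  refine Fin.cases ?_ (fun i => ?_) i
  · exact Or.inl ⟨a, fun x => rfl⟩
  · exact Or.inr ⟨i, 0, fun x => by simp⟩

/-- The facet of `edgeTip 0 x y x' y'` where coordinate `0` equals `1` is `tip x' y'`; the opposite
facet is `tip x y`. -/
theorem IsCubeMap.sim_of_edgeTip [Nilspace X] {k : ℕ} {x y x' y' : X}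
    (h : IsCubeMap (edgeTip 0 x y x' y' : Cube (k + 2) → X)) : Sim k x' y' := by
  rw [sim_iff]
  simpa [edgeTip_zero_cons] using h.comp (mor_cons 1)

theorem mor_tail {n : ℕ} : Mor (fun (v : Cube (n + 1)) (i : Fin n) => v i.succ) :=
  fun i => Or.inr ⟨i.succ, 0, fun x => by simp⟩

theorem edgeTip_zero_self {n : ℕ} (x y : X) :
    (edgeTip 0 x y x y : Cube (n + 1) → X) =
      fun v => tip x y fun i : Fin n => v i.succ := by
  funext v
  obtain ⟨a, c, rfl⟩ : ∃ a c, v = (Fin.cons a c : Cube (n + 1)) :=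
    ⟨v 0, Fin.tail v, (Fin.cons_self_tail v).symm⟩
  rw [edgeTip_zero_cons]
  simp

theorem Sim.isCubeMap_edgeTip_self [Nilspace X] {k : ℕ} {x y : X} (h : Sim k x y) :
    IsCubeMap (edgeTip 0 x y x y : Cube (k + 2) → X) := by
  rw [edgeTip_zero_self]
  exact (sim_iff.1 h).comp mor_tail

/-- Parallel transport of the pair `(x, y)` to the base point `x'`. -/
theorem Sim.exists_edgeTip [Nilspace X] {k : ℕ} {x y : X} (h : Sim k x y) (x' : X) :
    ∃ y', IsCubeMap (edgeTip 0 x y x' y' : Cube (k + 2) → X) := by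
  classical
  obtain ⟨Q, hQ, hQ'⟩ := exists_isCubeMap_extension {v : Cube (k + 2) | v ≠ 1}
    (fun a b hab ha hb => ha (le_antisymm (le_one_cube _) (hb ▸ hab)))
    (edgeTip 0 x y x' x') (by
      intro w hw
      -- A proper face either lies in the facet carrying `tip x y`, or misses the distinguished
      -- edge, and then the map depends on coordinate `0` only.
      by_cases hw' : ∀ i, i ≠ 0 → w i = 1
      · have hw0 : w 0 = 0 := by
          by_contra h0
          exact hw (funext fun i => by
            by_cases hi : i = 0
            · subst hi; exact fin_two_ne_zero.1 h0
            · exact hw' i hi)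
        convert h.isCubeMap_edgeTip_self.comp (mor_inf w) using 2 with v
        simp [edgeTip, hw0]
      · convert (isCubeMap_edge 0 x x').comp (mor_inf w) using 2 with v
        rw [edgeTip, if_neg]
        intro h
        apply hw'
        intro i hi
        exact le_antisymm (fin_two_le_one _) ((h i hi).symm.le.trans inf_le_right))
  refine ⟨Q 1, ?_⟩
  convert hQ using 1
  funext v
  by_cases hv : v = 1
  · subst hv; rw [edgeTip_one]
  · rw [hQ' v hv, edgeTip, edgeTip]
    have : (∀ i, i ≠ 0 → v i = 1) → v 0 = 0 := by
      intro h
      by_contra h0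
      exact hv (funext fun i => by
        by_cases hi : i = 0
        · subst hi; exact fin_two_ne_zero.1 h0
        · exact h i hi)
    split_ifs <;> simp_all

/-- Concatenation of two cubes along a common face. -/
theorem IsCubeMap.concat [Nilspace X] [Finite ι] [DecidableEq ι] {j : ι} {f g : (ι → Fin 2) → X}
    (hf : IsCubeMap f) (hg : IsCubeMap g) (h : ∀ v, v j = 0 → f v = g v) :
    IsCubeMap (fun v => if v j = 0 then f (Function.update v j 1) else g v) := by
  -- Subdivision matters only in direction `j`, with `f` on one side and `g` on the other. In every
  -- other direction the grid points `0, 1, 2` are sent to `0, 1, 1`.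
  have := isCubeMap_subdivision (fun a b : ι → Fin 2 =>
    if b j = 1 then f (Function.update (b + 1) j 1) else g (Function.update (b + 1) j (a j))) (by
      intro w
      have hmor : Mor (fun u : ι → Fin 2 => Function.update (u ⊓ (w + 1) + 1) j (u j)) := by
        intro i
        by_cases hi : i = j
        · subst hi
          exact Or.inr ⟨i, 0, fun x => by simp⟩
        · simp only [Function.update_of_ne hi]
          exact ((mor_add 1).comp (mor_inf (w + 1))) i
      rcases fin_two_cases (w j) with hw | hw
      · convert hf.comp hmor using 2 with u
        rcases fin_two_cases (u j) with hu | hu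
        · simp [hw, hu]
          rw [h _ (by simp)]
        · simp [hw, hu]
      · convert hg.comp hmor using 2 with u
        simp [hw, fin_two_inf_one])
  convert this using 2 with v
  have h2 : ∀ a : Fin 2, a + 1 = 1 ↔ a = 0 := by decide
  simp [h2, add_add_self]

/-- The two cubes share the facet carrying `x` and `y`; concatenating along it removes that facet.
-/
theorem IsCubeMap.edgeTip_trans [Nilspace X] [Finite ι] {j : ι} {x y x₀ y₀ x₁ y₁ : X}
    (h₀ : IsCubeMap (edgeTip j x y x₀ y₀)) (h₁ : IsCubeMap (edgeTip j x y x₁ y₁)) :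
    IsCubeMap (edgeTip j x₀ y₀ x₁ y₁) := by
  classical
  convert h₀.concat h₁ (j := j) (fun v hv => by simp [edgeTip, hv]) using 2 with v
  by_cases hv : v j = 0
  · have : (∀ i, i ≠ j → Function.update v j 1 i = 1) ↔ ∀ i, i ≠ j → v i = 1 :=
      forall_congr' fun i => imp_congr_right fun hi => by simp [hi]
    simp only [edgeTip, this]
    simp [hv]
  · simp only [edgeTip, hv, if_false]

-- The cells at the distinguished edge carry the cubes supplied by `hτ`, and the remaining cells
-- carry collapsed copies of `q`. In the outer cube the values along that edge are replaced by their
-- images under `τ`.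
open Classical in
theorem IsCubeMap.map_edge_one [Nilspace X] [Finite ι] {j : ι} {τ : X → X}
    (hτ : ∀ x y, IsCubeMap (edgeTip j x (τ x) y (τ y))) {q : (ι → Fin 2) → X}
    (hq : IsCubeMap q) :
    IsCubeMap (fun v => if ∀ i, i ≠ j → v i = 1 then τ (q v) else q v) := by
  have := isCubeMap_subdivision (fun a b : ι → Fin 2 =>
    if ∀ i, i ≠ j → a i = 1 then τ (q (Function.update 1 j (b j + 1))) else q (b + 1)) (by
      intro w
      by_cases hw : ∀ i, i ≠ j → w i = 1
      · have hmor : Mor (fun u : ι → Fin 2 => Function.update u j ((u ⊓ (w + 1) + 1) j)) := by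
          intro i
          by_cases hi : i = j
          · subst hi
            simp only [Function.update_self]
            exact ((mor_add 1).comp (mor_inf (w + 1))) i
          · exact Or.inr ⟨i, 0, fun x => by simp [hi]⟩
        convert (hτ (q (Function.update 1 j 0)) (q (Function.update 1 j 1))).comp hmor
          using 2 with u
        have h1 : (∀ i, i ≠ j → (u ⊓ w) i = 1) ↔ ∀ i, i ≠ j → u i = 1 :=
          forall_congr' fun i => imp_congr_right fun hi => by
            simp [hw i hi, fin_two_inf_one]
        have h2 : (∀ i, i ≠ j → Function.update u j ((u ⊓ (w + 1) + 1) j) i = 1) ↔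
            ∀ i, i ≠ j → u i = 1 :=
          forall_congr' fun i => imp_congr_right fun hi => by simp [hi]
        have h3 : u ⊓ (w + 1) + 1 = Function.update (1 : ι → Fin 2) j ((u ⊓ (w + 1) + 1) j) := by
          funext i
          by_cases hi : i = j
          · subst hi; simp
          · simp [hi, hw i hi]
        have h4 : (u ⊓ (w + 1)) j + 1 = (u ⊓ (w + 1) + 1) j := rfl
        simp only [edgeTip, h1, h2, h4, Function.update_self]
        rw [h3]
        simp only [Function.update_self]
        rcases fin_two_cases ((u ⊓ (w + 1) + 1) j) with h | h <;> simp [h]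
      · convert hq.comp ((mor_add 1).comp (mor_inf (w + 1))) using 2 with u
        rw [if_neg]
        intro h
        exact hw fun i hi =>
          le_antisymm (fin_two_le_one _) ((h i hi).symm.le.trans inf_le_right))
  convert this using 2 with v
  split_ifs with hv
  · congr 2
    funext i
    by_cases hi : i = j
    · subst hi
      have : ∀ a : Fin 2, a + 1 + 1 = a := by decide
      simp [this]
    · simp [hi, hv i hi]
  · rw [add_add_self]

open Classical in
/-- Applying `τ` along an edge of a `(k + 2)`-cube yields a cube; that is, `τ` is a translation
of height `k + 1`. -/
def IsTranslation [Cubespace X] (k : ℕ) (τ : X → X) : Prop :=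
  ∀ q : Cube (k + 2) → X, IsCubeMap q → ∀ (j : Fin (k + 2)) (w : Cube (k + 2)),
    IsCubeMap (fun v => if ∀ i, i ≠ j → v i = w i then τ (q v) else q v)

theorem isTranslation_of_edgeTip [Nilspace X] {k : ℕ} {τ : X → X}
    (hτ : ∀ x y, IsCubeMap (edgeTip 0 x (τ x) y (τ y) : Cube (k + 2) → X)) :
    IsTranslation k τ := by
  intro q hq j w
  have h1 := (hq.comp (mor_add (w + 1))).map_edge_one fun x y => (hτ x y).edgeTip_swap j
  convert h1.comp (mor_add (w + 1)) using 2 with v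
  simp only [add_add_self]
  have : ∀ i, (v + (w + 1)) i = 1 ↔ v i = w i := by
    have : ∀ a b : Fin 2, a + (b + 1) = 1 ↔ a = b := by decide
    exact fun i => this _ _
  simp only [this]

/-! ### The group of translations and its action. -/

theorem IsTranslation.id [Nilspace X] {k : ℕ} : IsTranslation k (fun x : X => x) := by
  intro q hq j w
  simpa using hq

theorem IsTranslation.comp [Nilspace X] {k : ℕ} {σ τ : X → X} (hσ : IsTranslation k σ)
    (hτ : IsTranslation k τ) : IsTranslation k (fun x => σ (τ x)) := by
  intro q hq j w
  convert hσ _ (hτ q hq j w) j w using 2 with v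
  split_ifs <;> rfl

theorem IsTranslation.isCubeMap_edgeTip [Nilspace X] {k : ℕ} {τ : X → X}
    (hτ : IsTranslation k τ) (x y : X) :
    IsCubeMap (edgeTip 0 x (τ x) y (τ y) : Cube (k + 2) → X) := by
  convert hτ _ (isCubeMap_edge 0 x y) 0 1 using 2 with v
  rw [edgeTip, apply_ite τ]
  congr

theorem IsTranslation.sim [Nilspace X] {k : ℕ} {τ : X → X}
    (hτ : IsTranslation k τ) (x : X) : Sim k x (τ x) :=
  (hτ.isCubeMap_edgeTip x x).sim_of_edgeTip

theorem edgeTip_unique [Nilspace X] {k : ℕ} (hX : IsStep (k + 1) X) {x y x' y' y'' : X}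
    (h : IsCubeMap (edgeTip 0 x y x' y' : Cube (k + 2) → X))
    (h' : IsCubeMap (edgeTip 0 x y x' y'' : Cube (k + 2) → X)) : y' = y'' := by
  have := hX.unique h h' fun v hv => by
    have : (∀ i, i ≠ 0 → v i = 1) → v 0 = 0 := by
      intro h
      by_contra h0
      exact hv (funext fun i => by
        by_cases hi : i = 0
        · subst hi; exact fin_two_ne_zero.1 h0
        · exact h i hi)
    rw [edgeTip, edgeTip]
    split_ifs <;> simp_all
  simpa [edgeTip_one] using congrFun this 1

/-- A translation is determined by one value: `τ` and the identity complete the same corner. This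
yields freeness of the action. -/
theorem IsTranslation.eq_id [Nilspace X] {k : ℕ} (hX : IsStep (k + 1) X) {τ : X → X}
    (hτ : IsTranslation k τ) {x : X} (hx : τ x = x) (y : X) : τ y = y := by
  have h1 := hτ.isCubeMap_edgeTip x y
  have h2 := (IsTranslation.id (k := k)).isCubeMap_edgeTip x y
  rw [hx] at h1
  exact edgeTip_unique hX h1 h2

/-- Start from a constant cube and apply `τ` and `σ` along two edges that meet only at the vertex
`1`. The two orders give cubes that agree off this vertex, hence everywhere. -/
theorem IsTranslation.comm [Nilspace X] {k : ℕ} (hX : IsStep (k + 1) X) {σ τ : X → X}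
    (hσ : IsTranslation k σ) (hτ : IsTranslation k τ) (x : X) : σ (τ x) = τ (σ x) := by
  classical
  have h1 := hσ _ (hτ _ (isCubeMap_const x) 0 1) 1 1
  have h2 := hτ _ (hσ _ (isCubeMap_const x) 1 1) 0 1
  have := hX.unique h1 h2 fun v hv => by
    by_cases hv0 : ∀ i, i ≠ 0 → v i = (1 : Cube (k + 2)) i
    · have hv1 : ¬ ∀ i, i ≠ 1 → v i = (1 : Cube (k + 2)) i := fun hv1 => hv (funext fun i => by
        by_cases hi : i = 0
        · subst hi; exact hv1 0 (by simp)
        · exact hv0 i hi)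
      simp only [hv1, if_false]
    · simp only [hv0, if_false]
  simpa using congrFun this 1

theorem Sim.exists_isTranslation [Nilspace X] {k : ℕ} (hX : IsStep (k + 1) X) {x y : X}
    (h : Sim k x y) : ∃ τ : X → X, IsTranslation k τ ∧ τ x = y := by
  -- Completions at different base points share the facet `tip x y`, so any two of them combine to
  -- the cube required of a translation.
  choose τ hτ using h.exists_edgeTip
  exact ⟨τ, isTranslation_of_edgeTip fun a b => (hτ a).edgeTip_trans (hτ b),
    edgeTip_unique hX (hτ x) h.isCubeMap_edgeTip_self⟩

/-- The group of translations of height `k + 1`. -/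
def translationGroup (X : Type u) [Nilspace X] (k : ℕ) : Subgroup (Equiv.Perm X) where
  carrier := {σ | IsTranslation k σ ∧ IsTranslation k (σ⁻¹ : Equiv.Perm X)}
  mul_mem' := by
    rintro σ τ ⟨h1, h2⟩ ⟨h3, h4⟩
    refine ⟨h1.comp h3, ?_⟩
    rw [mul_inv_rev]
    exact h4.comp h2
  one_mem' := ⟨IsTranslation.id, by rw [inv_one]; exact IsTranslation.id⟩
  inv_mem' := by
    rintro σ ⟨h1, h2⟩
    exact ⟨h2, by rwa [inv_inv]⟩

/-- Transport from `x` to `y` and transport from `y` to `x` are mutually inverse, since each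
composite fixes a point. -/
theorem Sim.exists_mem_translationGroup [Nilspace X] {k : ℕ} (hX : IsStep (k + 1) X) {x y : X}
    (h : Sim k x y) : ∃ σ ∈ translationGroup X k, σ x = y := by
  obtain ⟨τ, hτ, hx⟩ := h.exists_isTranslation hX
  obtain ⟨σ, hσ, hy⟩ := h.symm.exists_isTranslation hX
  exact ⟨⟨τ, σ, (hσ.comp hτ).eq_id hX (by rw [hx, hy]), (hτ.comp hσ).eq_id hX (by rw [hy, hx])⟩,
    ⟨hτ, hσ⟩, hx⟩

/-- The structure group of a `(k + 1)`-step nilspace. -/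
theorem exists_structureGroup [Nilspace X] {k : ℕ} (hX : IsStep (k + 1) X) :
    ∃ (A : Type u) (_ : AddCommGroup A) (_ : AddAction A X),
      (∀ (x : X) (a : A), a +ᵥ x = x → a = 0) ∧ (∀ a : A, IsTranslation k (fun x : X => a +ᵥ x)) ∧
      ∀ x y : X, Sim k x y → ∃ a : A, a +ᵥ x = y := by
  let C : CommGroup (translationGroup X k) :=
    { (inferInstance : Group (translationGroup X k)) with
      mul_comm := fun σ τ => Subtype.ext (Equiv.ext fun x => σ.2.1.comm hX τ.2.1 x) }
  refine ⟨Additive (translationGroup X k), inferInstance,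
    (inferInstance : AddAction (Additive (translationGroup X k)) X), ?_, fun a => a.toMul.2.1, ?_⟩
  · intro x a ha
    exact Additive.toMul.injective
      (Subtype.ext (Equiv.ext fun y => a.toMul.2.1.eq_id hX ha y))
  · intro x y h
    obtain ⟨σ, hσ, hx⟩ := h.exists_mem_translationGroup hX
    exact ⟨Additive.ofMul ⟨σ, hσ⟩, hx⟩

/-! ## Cubes over a given cube of the last factor -/

/-- The sign `(-1)^|v|` of a vertex. -/
def sign {n : ℕ} (v : Cube n) : ℤ := (-1) ^ (∑ i, (v i : ℕ))

theorem sign_mul_self {n : ℕ} (v : Cube n) : sign v * sign v = 1 := by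
  rw [sign, ← pow_add, Even.neg_one_pow ⟨_, rfl⟩]

theorem sign_update {n : ℕ} {v : Cube n} {j : Fin n} (h : v j = 0) :
    sign (Function.update v j 1) = -sign v := by
  have h1 : ∑ i, ((Function.update v j 1 : Cube n) i : ℕ) = (∑ i, (v i : ℕ)) + 1 := by
    rw [← Finset.add_sum_erase _ _ (Finset.mem_univ j),
      ← Finset.add_sum_erase (a := j) (f := fun i => (v i : ℕ)) _ (Finset.mem_univ j), h]
    simp only [Function.update_self]
    rw [Finset.sum_congr rfl fun i hi => by
      rw [Function.update_of_ne (Finset.ne_of_mem_erase hi)]]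
    simp [add_comm]
  rw [sign, sign, h1, pow_succ, mul_neg_one]

/-- The alternating sum of a function on the vertices of a cube. -/
def altSum {n : ℕ} {A : Type z} [AddCommGroup A] (g : Cube n → A) : A := ∑ v, sign v • g v

/-- The two ends of an edge have opposite signs. -/
theorem altSum_edge {n : ℕ} {A : Type z} [AddCommGroup A] {g : Cube n → A} {w : Cube n}
    {j : Fin n} (hw : w j = 0) (hg : ∀ v, v ≠ w → v ≠ Function.update w j 1 → g v = 0)
    (h : altSum g = 0) : g w = g (Function.update w j 1) := by
  have hne : w ≠ Function.update w j 1 := fun h => by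
    have := congrFun h j
    simp [hw] at this
  rw [altSum, Finset.sum_eq_add w (Function.update w j 1) hne
    (fun v _ hv => by rw [hg v hv.1 hv.2, smul_zero]) (by simp) (by simp), sign_update hw,
    neg_smul, ← sub_eq_add_neg, ← smul_sub] at h
  have h2 := congrArg (fun a => sign w • a) h
  simp only [smul_smul, sign_mul_self, one_smul, smul_zero] at h2
  exact sub_eq_zero.1 h2

section

variable {A : Type z} [AddCommGroup A] [AddAction A X]

/-- The functions whose addition preserves the `n`-cubes. -/
def cubeShifts (X : Type u) [Nilspace X] (A : Type z) [AddCommGroup A] [AddAction A X] (n : ℕ) :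
    AddSubmonoid (Cube n → A) where
  carrier := {g | ∀ q : Cube n → X, IsCubeMap q → IsCubeMap (fun v => g v +ᵥ q v)}
  add_mem' := by
    intro g h hg hh q hq
    simpa only [Pi.add_apply, add_vadd] using hg _ (hh q hq)
  zero_mem' := by
    intro q hq
    simpa using hq

theorem edge_mem_cubeShifts [Nilspace X] {k : ℕ}
    (hA : ∀ a : A, IsTranslation k (fun x : X => a +ᵥ x)) {w : Cube (k + 2)} {j : Fin (k + 2)}
    (hw : w j = 0) (a : A) :
    (Pi.single w a + Pi.single (Function.update w j 1) a : Cube (k + 2) → A) ∈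
      cubeShifts X A (k + 2) := by
  classical
  intro q hq
  convert hA a q hq j w using 2 with v
  have hne : w ≠ Function.update w j 1 := fun h => by
    have := congrFun h j
    simp [hw] at this
  by_cases hv : ∀ i, i ≠ j → v i = w i
  · rw [if_pos hv]
    have hv' : v = Function.update w j (v j) := by
      funext i
      by_cases hi : i = j
      · subst hi; simp
      · simp [hi, hv i hi]
    rcases fin_two_cases (v j) with h | h
    · rw [h, ← hw, Function.update_eq_self] at hv'
      subst hv'
      simp [hne]
    · rw [h] at hv'
      subst hv'
      simp [hne.symm]
  · rw [if_neg hv]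
    have h1 : v ≠ w := fun h => hv fun i _ => by rw [h]
    have h2 : v ≠ Function.update w j 1 := fun h => hv fun i hi => by simp [h, hi]
    simp [h1, h2]

/-- An element is pushed from `w` up to the vertex `1` one edge at a time, changing sign at every
step; hence the induction downwards from `1`. -/
theorem single_mem_cubeShifts [Nilspace X] {k : ℕ}
    (hA : ∀ a : A, IsTranslation k (fun x : X => a +ᵥ x)) (w : Cube (k + 2)) (a : A) :
    (Pi.single w a - Pi.single 1 ((sign w * sign (1 : Cube (k + 2))) • a) : Cube (k + 2) → A) ∈
      cubeShifts X A (k + 2) := by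
  induction w using WellFoundedGT.induction generalizing a with
  | ind w ih =>
  by_cases hw : w = 1
  · subst hw
    rw [sign_mul_self, one_smul, sub_self]
    exact zero_mem _
  · obtain ⟨j, hj⟩ : ∃ j, w j = 0 := by
      by_contra! h
      exact hw (funext fun j => fin_two_ne_zero.1 (h j))
    have hlt : w < Function.update w j 1 := by
      refine lt_of_le_of_ne (fun i => ?_) fun h => ?_
      · by_cases hi : i = j
        · subst hi; rw [hj]; exact fin_two_zero_le _
        · rw [Function.update_of_ne hi]
      · have := congrFun h j
        simp [hj] at this
    have h := add_mem (edge_mem_cubeShifts hA hj a) (ih _ hlt (-a))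
    convert h using 1
    rw [sign_update hj, neg_mul, neg_smul, smul_neg, neg_neg, Pi.single_neg]
    abel

theorem sub_altSum_mem_cubeShifts [Nilspace X] {k : ℕ}
    (hA : ∀ a : A, IsTranslation k (fun x : X => a +ᵥ x)) (g : Cube (k + 2) → A) :
    g - Pi.single 1 (sign (1 : Cube (k + 2)) • altSum g) ∈ cubeShifts X A (k + 2) := by
  have h := sum_mem (t := Finset.univ) fun w _ => single_mem_cubeShifts hA w (g w)
  convert h using 1
  rw [Finset.sum_sub_distrib, Finset.univ_sum_single]
  congr 1
  rw [altSum, Finset.smul_sum]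
  have := map_sum (AddMonoidHom.single (fun _ : Cube (k + 2) => A) 1)
    (fun w => (sign w * sign (1 : Cube (k + 2))) • g w) Finset.univ
  simp only [AddMonoidHom.single_apply] at this
  rw [← this]
  simp only [smul_smul, mul_comm]

/-- Up to admissible shifts, `g` is concentrated at the vertex `1` with value `± altSum g`. By
unique completion and freeness, that value must vanish. -/
theorem isCubeMap_vadd_iff_altSum [Nilspace X] {k : ℕ} (hX : IsStep (k + 1) X)
    (hfree : ∀ (x : X) (a : A), a +ᵥ x = x → a = 0)
    (hA : ∀ a : A, IsTranslation k (fun x : X => a +ᵥ x)) {q : Cube (k + 2) → X}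
    (hq : IsCubeMap q) (g : Cube (k + 2) → A) :
    IsCubeMap (fun v => g v +ᵥ q v) ↔ altSum g = 0 := by
  have h := sub_altSum_mem_cubeShifts hA g
  constructor
  · intro hg
    have h1 := hX.unique (h q hq) hg fun v hv => by simp [hv]
    have h2 := congrFun h1 1
    simp only [Pi.sub_apply, Pi.single_eq_same] at h2
    rw [sub_eq_neg_add, add_vadd] at h2
    have h3 := neg_eq_zero.1 (hfree _ _ h2)
    have h4 := congrArg (fun a => sign (1 : Cube (k + 2)) • a) h3
    simpa only [smul_smul, sign_mul_self, one_smul, smul_zero] using h4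
  · intro h0
    rw [h0, smul_zero, Pi.single_zero, sub_zero] at h
    exact h q hq

theorem isCubeMap_vadd_iff [Nilspace X] {k : ℕ} (hX : IsStep (k + 1) X)
    (hfree : ∀ (x : X) (a : A), a +ᵥ x = x → a = 0)
    (hA : ∀ a : A, IsTranslation k (fun x : X => a +ᵥ x)) {n : ℕ} {q : Cube n → X}
    (hq : IsCubeMap q) (g : Cube n → A) :
    IsCubeMap (fun v => g v +ᵥ q v) ↔ g ∈ degreeCubes (k + 1) A n := by
  constructor
  · intro hg φ hφ
    exact (isCubeMap_vadd_iff_altSum hX hfree hA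
      (isCubeMap_iff.2 (Cubespace.comp_mem φ hφ.1 _ (isCubeMap_iff.1 hq))) (fun v => g (φ v))).1
      (isCubeMap_iff.2 (Cubespace.comp_mem φ hφ.1 _ (isCubeMap_iff.1 hg)))
  · intro hg
    -- Translating within classes of `∼_k` preserves cubes on faces of dimension at most `k + 1`.
    -- The extension `Q` of these is then compared with `g +ᵥ q` on `(k+2)`-faces, where completions
    -- are unique.
    obtain ⟨Q, hQ, hQ'⟩ := exists_isCubeMap_extension {v : Cube n | weight v ≤ k + 1}
      (fun a b hab ha => (weight_mono hab).trans ha) (fun v => g v +ᵥ q v)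
      (fun w hw => hq.of_sim_face hw fun v _ => (hA (g v)).sim (q v))
    suffices h : Q = fun v => g v +ᵥ q v by rwa [← h]
    funext w
    induction w using WellFoundedLT.induction with
    | ind w ih =>
    by_cases hw : weight w ≤ k + 1
    · exact hQ' w hw
    · obtain ⟨e, he, hw1⟩ := exists_injective_of_le_weight (m := k + 2) (w := w) (by omega)
      have h1 := (isCubeMap_vadd_iff_altSum hX hfree hA (hq.comp (mor_faceEmb he (w := w)))
        (fun c => g (faceEmb e w c))).2 (hg (faceEmb e w) (isFaceMap_faceEmb he w))
      have h2 := hX.unique (hQ.comp (mor_faceEmb he (w := w))) h1 fun c hc =>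
        ih _ (faceEmb_lt he hw1 hc)
      have h3 := congrFun h2 1
      simpa only [faceEmb_one he hw1] using h3

end

/-! ## Abelian bundles -/

section IsAbelianBundle

variable {A : Type z} [AddCommGroup A] {B S : Type w} [AddAction A B] {π : B → S}

theorem isAbelianBundle_of_surjective (hfree : ∀ (x : B) (a : A), a +ᵥ x = x → a = 0)
    (hsurj : Function.Surjective π) (h : ∀ b b', π b = π b' ↔ ∃ a : A, a +ᵥ b = b') :
    IsAbelianBundle A π := by
  have key : ∀ b, π ⁻¹' {π b} = AddAction.orbit A b := by
    intro b
    ext b'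
    rw [Set.mem_preimage, Set.mem_singleton_iff, eq_comm, h]
    rfl
  refine ⟨hfree, ?_, ?_, ?_⟩
  · intro s _
    obtain ⟨b, rfl⟩ := hsurj s
    exact ⟨b, (key b).symm⟩
  · intro s _ t _ hst
    obtain ⟨b, rfl⟩ := hsurj s
    have : b ∈ π ⁻¹' {t} := by
      rw [← show π ⁻¹' {π b} = π ⁻¹' {t} from hst]
      rfl
    exact this
  · rintro _ ⟨b, rfl⟩
    exact ⟨π b, trivial, key b⟩

theorem IsAbelianBundle.surjective (h : IsAbelianBundle A π) : Function.Surjective π := by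
  intro s
  obtain ⟨x, hx⟩ := h.fibres.mapsTo (Set.mem_univ s)
  have : x ∈ π ⁻¹' {s} := by
    rw [← show _ = π ⁻¹' {s} from hx]
    exact AddAction.mem_orbit_self x
  exact ⟨x, this⟩

theorem IsAbelianBundle.eq_iff (h : IsAbelianBundle A π) (b b' : B) :
    π b = π b' ↔ ∃ a : A, a +ᵥ b = b' := by
  obtain ⟨s, -, hs⟩ := h.fibres.surjOn ⟨b, rfl⟩
  have hs' : π ⁻¹' {s} = AddAction.orbit A b := hs
  have hb : π b = s := by
    have : b ∈ π ⁻¹' {s} := hs' ▸ AddAction.mem_orbit_self b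
    exact this
  have h2 : π b' = s ↔ b' ∈ AddAction.orbit A b := by
    rw [← hs']; rfl
  rw [hb, eq_comm, h2]
  rfl

theorem IsAbelianBundle.vadd_injective (h : IsAbelianBundle A π) {a a' : A} {b : B}
    (hab : a +ᵥ b = a' +ᵥ b) : a = a' := by
  have h2 : (-a' + a) +ᵥ b = b := by
    rw [add_vadd, hab, neg_vadd_vadd]
  exact (neg_add_eq_zero.1 (h.free b _ h2)).symm

end IsAbelianBundle

/-! ## The bundle of characteristic factors -/

namespace CharFactor

/-- The projection `X/∼_{i+1} → X/∼_i`. -/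
def proj (X : Type u) [Nilspace X] (i : ℕ) : CharFactor X (i + 1) → CharFactor X i :=
  Quotient.map' id fun _ _ h => h.mono (Nat.le_succ i)

theorem proj_mk [Nilspace X] (i : ℕ) (x : X) : proj X i (mk (i + 1) x) = mk i x := rfl

theorem proj_surjective [Nilspace X] (i : ℕ) : Function.Surjective (proj X i) := by
  intro s
  obtain ⟨x, rfl⟩ := mk_surjective i s
  exact ⟨mk _ x, rfl⟩

theorem proj_eq_iff [Nilspace X] {i : ℕ} (b b' : CharFactor X (i + 1)) :
    proj X i b = proj X i b' ↔ Sim i b b' := by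
  obtain ⟨x, rfl⟩ := mk_surjective _ b
  obtain ⟨y, rfl⟩ := mk_surjective _ b'
  rw [proj_mk, proj_mk, mk_eq_iff, sim_mk_iff (Nat.le_succ i)]

end CharFactor

theorem exists_characteristicBundle [Nilspace X] {k : ℕ} [Nonempty X] (hX : IsStep k X) :
    ∃ D : KFoldAbelianBundle.{u, u, u} k X, D.IsDegreeBundle ∧ D.HasCharacteristicFactors := by
  -- The index is shifted: `A i` is the structure group of the `(i+1)`-step nilspace `X/∼_{i+1}`,
  -- and its orbits are the fibres over `X/∼_i`.
  choose A iC iA hfree htrans hsim using fun i : ℕ =>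
    exists_structureGroup (CharFactor.isStep (X := X) (i + 1))
  have hproj : ∀ (i : ℕ) (b b' : CharFactor X (i + 1)),
      CharFactor.proj X i b = CharFactor.proj X i b' ↔ ∃ a : A i, a +ᵥ b = b' := by
    intro i b b'
    rw [CharFactor.proj_eq_iff]
    refine ⟨hsim i b b', ?_⟩
    rintro ⟨a, rfl⟩
    exact (htrans i a).sim b
  have hbundle : ∀ i : ℕ, IsAbelianBundle (A i) (CharFactor.proj X i) := fun i =>
    isAbelianBundle_of_surjective (hfree i) (CharFactor.proj_surjective _) (hproj i)
  have hfibre : ∀ (i n : ℕ) (q q₂ : Cube n → CharFactor X (i + 1)), IsCubeMap q →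
      ((q₂ ∈ Cubespace.cubes n ∧ CharFactor.proj X i ∘ q = CharFactor.proj X i ∘ q₂) ↔
        ∃ g ∈ degreeCubes (i + 1) (A i) n, q₂ = fun v => g v +ᵥ q v) := by
    intro i n q q₂ hq
    have hiff := isCubeMap_vadd_iff (CharFactor.isStep (X := X) (i + 1)) (hfree i) (htrans i) hq
    constructor
    · rintro ⟨h1, h2⟩
      choose g hg using fun v => (hproj i (q v) (q₂ v)).1 (congrFun h2 v)
      obtain rfl : (fun v => g v +ᵥ q v) = q₂ := funext hg
      exact ⟨g, (hiff g).1 (isCubeMap_iff.2 h1), rfl⟩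
    · rintro ⟨g, hg, rfl⟩
      exact ⟨isCubeMap_iff.1 ((hiff g).2 hg), funext fun v => (hproj i _ _).2 ⟨g v, rfl⟩⟩
  have hbij : Function.Bijective (CharFactor.mk (X := X) k) :=
    ⟨fun x y h => hX.eq_of_sim (CharFactor.mk_eq_iff.1 h), CharFactor.mk_surjective k⟩
  let D : KFoldAbelianBundle.{u, u, u} k X :=
    { factor := fun i => CharFactor X (i : ℕ)
      group := fun i => A i
      addCommGroup := fun i => iC i
      addAction := fun i => iA i
      proj := fun i => CharFactor.proj X i
      total := Equiv.ofBijective _ hbij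
      ground_nonempty := ⟨CharFactor.mk 0 (Classical.arbitrary X)⟩
      ground_subsingleton := by
        refine ⟨fun a b => ?_⟩
        obtain ⟨x, rfl⟩ := CharFactor.mk_surjective _ a
        obtain ⟨y, rfl⟩ := CharFactor.mk_surjective _ b
        refine CharFactor.mk_eq_iff.2 (sim_iff.2 (isCubeMap_iff.2 ?_))
        have : (Cubespace.cubes 1 : Set (Cube 1 → X)) = Set.univ := Nilspace.ergodic
        exact this.symm ▸ Set.mem_univ _
      isAbelianBundle := fun i => hbundle i }
  have hD : ∀ i x, D.toFactor i x = CharFactor.mk (i : ℕ) x := by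
    intro i
    induction i using Fin.reverseInduction with
    | last => intro x; rw [D.toFactor_last]; rfl
    | cast i ih =>
      intro x
      rw [D.toFactor_castSucc, Function.comp, ih]
      rfl
  have hcubes : ∀ i n, D.factorCubes i n = Cubespace.cubes (X := CharFactor X (i : ℕ)) n := by
    intro i n
    have : D.toFactor i = CharFactor.mk (i : ℕ) := funext (hD i)
    rw [KFoldAbelianBundle.factorCubes, this]
    rfl
  refine ⟨D, ?_, fun i => ⟨?_, fun x y => ?_⟩⟩
  · intro i n q hq
    rw [hcubes] at hq
    ext q₂
    rw [hcubes]
    exact hfibre i n q q₂ (isCubeMap_iff.2 hq)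
  · rw [funext (hD i)]
    exact CharFactor.mk_surjective _
  · rw [hD, hD, CharFactor.mk_eq_iff]

/-! ## Morphisms of degree-`k` bundles -/

theorem isFaceMap_id (n : ℕ) : IsFaceMap (fun v : Cube n => v) :=
  ⟨Mor.id.isCubeMorphism, Function.injective_id, ∅, 0, by simp, by ext; simp⟩

theorem altSum_eq_zero {A : Type z} [AddCommGroup A] {m : ℕ} {g : Cube (m + 1) → A}
    (hg : g ∈ degreeCubes m A (m + 1)) : altSum g = 0 :=
  hg _ (isFaceMap_id _)

/-- The condition is vacuous: an `(m+1)`-cube does not inject into an `n`-cube. -/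
theorem mem_degreeCubes_of_le {A : Type z} [AddCommGroup A] {m n : ℕ} (h : n ≤ m)
    (g : Cube n → A) : g ∈ degreeCubes m A n := by
  intro φ hφ
  have h1 := Fintype.card_le_of_injective φ hφ.2.1
  simp only [Fintype.card_fun, Fintype.card_fin] at h1
  have h2 := (Nat.pow_le_pow_iff_right (by norm_num : 1 < 2)).1 h1
  omega

namespace KFoldAbelianBundle

variable {k : ℕ} (D : KFoldAbelianBundle.{u, w, z} k X)

theorem toFactor_castSucc_apply (i : Fin k) (x : X) :
    D.toFactor i.castSucc x = D.proj i (D.toFactor i.succ x) := by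
  rw [D.toFactor_castSucc]; rfl

theorem toFactor_surjective (i : Fin (k + 1)) : Function.Surjective (D.toFactor i) := by
  induction i using Fin.reverseInduction with
  | last => rw [D.toFactor_last]; exact D.total.surjective
  | cast i ih =>
    rw [D.toFactor_castSucc]
    exact (D.isAbelianBundle i).surjective.comp ih

theorem toFactor_castSucc_eq_iff (i : Fin k) (x y : X) :
    D.toFactor i.castSucc x = D.toFactor i.castSucc y ↔
      ∃ a : D.group i, a +ᵥ D.toFactor i.succ x = D.toFactor i.succ y := by
  rw [toFactor_castSucc_apply, toFactor_castSucc_apply, (D.isAbelianBundle i).eq_iff]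

theorem IsDegreeBundle.exists_vadd {D : KFoldAbelianBundle.{u, w, z} k X} [Nilspace X]
    (hD : D.IsDegreeBundle) (i : Fin k)
    {n : ℕ} {q q₂ : Cube n → X} (hq : IsCubeMap q) (hq₂ : IsCubeMap q₂)
    (h : ∀ v, D.toFactor i.castSucc (q v) = D.toFactor i.castSucc (q₂ v)) :
    ∃ g ∈ degreeCubes ((i : ℕ) + 1) (D.group i) n,
      ∀ v, D.toFactor i.succ (q₂ v) = g v +ᵥ D.toFactor i.succ (q v) := by
  have h1 := hD i n (D.toFactor i.succ ∘ q) ⟨q, isCubeMap_iff.1 hq, rfl⟩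
  have h2 : D.toFactor i.succ ∘ q₂ ∈ {q₂ | q₂ ∈ D.factorCubes i.succ n ∧
      D.proj i ∘ (D.toFactor i.succ ∘ q) = D.proj i ∘ q₂} := by
    refine ⟨⟨q₂, isCubeMap_iff.1 hq₂, rfl⟩, funext fun v => ?_⟩
    simpa only [toFactor_castSucc_apply, Function.comp] using h v
  rw [h1] at h2
  obtain ⟨g, hg, hg'⟩ := h2
  exact ⟨g, hg, fun v => congrFun hg' v⟩

/-- Climb the tower from `B_i` to `X`: in dimension at most `i + 1`, all shifts are allowed at each
level, so being a cube depends on the projection to `B_i` only. -/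
theorem IsDegreeBundle.mem_cubes {D : KFoldAbelianBundle.{u, w, z} k X} [Nilspace X]
    (hD : D.IsDegreeBundle) (i : Fin (k + 1))
    {n : ℕ} (hn : n ≤ i + 1) {f : Cube n → X} (hf : D.toFactor i ∘ f ∈ D.factorCubes i n) :
    f ∈ Cubespace.cubes (X := X) n := by
  induction i using Fin.reverseInduction with
  | last =>
    obtain ⟨q, hq, hqf⟩ := hf
    rw [D.toFactor_last] at hqf
    obtain rfl : q = f := funext fun v => D.total.injective (congrFun hqf v)
    exact hq
  | cast i ih =>
    refine ih (hn.trans (by simp)) ?_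
    obtain ⟨q, hq, hqf⟩ := hf
    choose g hg using fun v => (D.toFactor_castSucc_eq_iff i (q v) (f v)).1 (congrFun hqf v)
    have h1 := hD i n (D.toFactor i.succ ∘ q) ⟨q, hq, rfl⟩
    have h2 : D.toFactor i.succ ∘ f ∈ {q₂ | ∃ q₃ ∈ degreeCubes ((i : ℕ) + 1) (D.group i) n,
        q₂ = fun x => q₃ x +ᵥ (D.toFactor i.succ ∘ q) x} :=
      ⟨g, mem_degreeCubes_of_le (by simpa using hn) g, funext fun v => (hg v).symm⟩
    rw [← h1] at h2
    exact h2.1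

/-- The factors of a degree-`k` bundle are the characteristic factors. -/
theorem IsDegreeBundle.toFactor_eq_iff {D : KFoldAbelianBundle.{u, w, z} k X} [Nilspace X]
    (hD : D.IsDegreeBundle) (i : Fin (k + 1)) (x y : X) :
    D.toFactor i x = D.toFactor i y ↔ Sim (i : ℕ) x y := by
  constructor
  · intro h
    refine sim_iff.2 (isCubeMap_iff.2 (hD.mem_cubes i le_rfl ?_))
    rw [comp_tip, ← h, tip_self]
    exact ⟨_, isCubeMap_iff.1 (isCubeMap_const x), rfl⟩
  · induction i using Fin.induction with
    | zero => exact fun _ => D.ground_subsingleton.elim _ _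
    | succ i ih =>
      intro h
      have hcast := ih (h.mono (by simp))
      -- The constant cube and the tip cube agree in `B_i`, so in `B_{i+1}` they differ by a shift
      -- `g` supported at the vertex `1`. Its vanishing alternating sum gives `g 1 = 0`.
      obtain ⟨g, hg, hg'⟩ := hD.exists_vadd i (isCubeMap_const x) (sim_iff.1 h) fun v => by
        by_cases hv : v = 1
        · rw [hv, tip_one, hcast]
        · rw [tip_of_ne _ _ hv]
      have h0 : ∀ v, v ≠ 1 → g v = 0 := fun v hv => by
        have := hg' v
        rw [tip_of_ne _ _ hv] at this
        exact (D.isAbelianBundle i).free _ _ this.symm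
      have hup : Function.update (Function.update (1 : Cube ((i : ℕ) + 2)) 0 0) 0 1 = 1 := by
        simp
      have hne : Function.update (1 : Cube ((i : ℕ) + 2)) 0 0 ≠ 1 := fun h => by
        simpa using congrFun h 0
      have h1 := altSum_edge (w := Function.update (1 : Cube ((i : ℕ) + 2)) 0 0) (j := 0)
        (by simp) (fun v _ hv => h0 v (by rwa [hup] at hv)) (altSum_eq_zero hg)
      rw [hup, h0 _ hne] at h1
      have h2 := hg' 1
      rw [tip_one, ← h1, zero_vadd] at h2
      exact h2.symm

/-- In `B_{i+1}` this cube is the shift of one depending on coordinate `0` only. The shift is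
supported on a single edge, with end values `a₀` and `a₁`, which its vanishing alternating sum makes
equal. -/
theorem IsDegreeBundle.eq_of_edgeTip {D : KFoldAbelianBundle.{u, w, z} k X} [Nilspace X]
    (hD : D.IsDegreeBundle) (i : Fin k)
    {x₀ y₀ x₁ y₁ : X} (h : IsCubeMap (edgeTip 0 x₀ y₀ x₁ y₁ : Cube ((i : ℕ) + 2) → X))
    {a₀ a₁ : D.group i} (h₀ : a₀ +ᵥ D.toFactor i.succ x₀ = D.toFactor i.succ y₀)
    (h₁ : a₁ +ᵥ D.toFactor i.succ x₁ = D.toFactor i.succ y₁) : a₀ = a₁ := by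
  have hc₀ := (D.toFactor_castSucc_eq_iff i x₀ y₀).2 ⟨a₀, h₀⟩
  have hc₁ := (D.toFactor_castSucc_eq_iff i x₁ y₁).2 ⟨a₁, h₁⟩
  obtain ⟨g, hg, hg'⟩ := hD.exists_vadd i (isCubeMap_edge 0 x₀ x₁) h fun v => by
    simp only [edgeTip]
    split_ifs <;> simp_all
  have hup : Function.update (Function.update (1 : Cube ((i : ℕ) + 2)) 0 0) 0 1 = 1 := by
    simp
  have h2 := altSum_edge (w := Function.update (1 : Cube ((i : ℕ) + 2)) 0 0) (j := 0)
    (by simp) (fun v hv hv' => by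
      have := hg' v
      rw [edgeTip, if_neg] at this
      · exact (D.isAbelianBundle i).free _ _ this.symm
      · intro hedge
        rcases fin_two_cases (v 0) with h0 | h0
        · apply hv
          funext j
          by_cases hj : j = 0
          · subst hj; simp [h0]
          · simp [hj, hedge j hj]
        · apply hv'
          rw [hup]
          funext j
          by_cases hj : j = 0
          · subst hj; simp [h0]
          · simp [hedge j hj]) (altSum_eq_zero hg)
  rw [hup] at h2
  have e0 := hg' (Function.update 1 0 0)
  have e1 := hg' 1
  rw [edgeTip, if_pos (fun j hj => by simp [hj])] at e0
  simp only [Function.update_self, if_true] at e0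
  rw [edgeTip_one] at e1
  simp only [Pi.one_apply, one_ne_zero, if_false] at e1
  rw [← h₀] at e0
  rw [← h₁] at e1
  rw [(D.isAbelianBundle i).vadd_injective e0, (D.isAbelianBundle i).vadd_injective e1, h2]

end KFoldAbelianBundle

/-! ### Maps induced by a nilspace morphism. -/

theorem IsNilspaceMorphism.comp_isCubeMap {X' : Type v} [Nilspace X] [Nilspace X'] {ψ : X → X'}
    (hψ : IsNilspaceMorphism ψ) {n : ℕ} {q : Cube n → X} (hq : IsCubeMap q) :
    IsCubeMap (ψ ∘ q) :=
  isCubeMap_iff.2 (hψ n q (isCubeMap_iff.1 hq))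

theorem IsNilspaceMorphism.sim {X' : Type v} [Nilspace X] [Nilspace X'] {ψ : X → X'}
    (hψ : IsNilspaceMorphism ψ) {i : ℕ} {x y : X} (h : Sim i x y) : Sim i (ψ x) (ψ y) := by
  have := hψ.comp_isCubeMap (sim_iff.1 h)
  rw [comp_tip] at this
  exact sim_iff.2 this

/-- Independence of the base point. Transporting `(x₀, y₀)` to `x₁` gives a cube of `X` whose image
under `ψ` is again an `edgeTip`, so the same group element acts at both ends in `X'`. -/
theorem IsNilspaceMorphism.structure_unique {X' : Type v} [Nilspace X] [Nilspace X'] {ψ : X → X'}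
    (hψ : IsNilspaceMorphism ψ) {k : ℕ} {D : KFoldAbelianBundle.{u, w, z} k X}
    {D' : KFoldAbelianBundle.{v, w', z'} k X'} (hD : D.IsDegreeBundle) (hD' : D'.IsDegreeBundle)
    (i : Fin k) {a : D.group i} {c₀ c₁ : D'.group i} {x₀ y₀ x₁ y₁ : X}
    (h₀ : a +ᵥ D.toFactor i.succ x₀ = D.toFactor i.succ y₀)
    (h₁ : a +ᵥ D.toFactor i.succ x₁ = D.toFactor i.succ y₁)
    (h₀' : c₀ +ᵥ D'.toFactor i.succ (ψ x₀) = D'.toFactor i.succ (ψ y₀))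
    (h₁' : c₁ +ᵥ D'.toFactor i.succ (ψ x₁) = D'.toFactor i.succ (ψ y₁)) : c₀ = c₁ := by
  have hsim : Sim (i : ℕ) x₀ y₀ :=
    (hD.toFactor_eq_iff i.castSucc _ _).1 ((D.toFactor_castSucc_eq_iff i _ _).2 ⟨a, h₀⟩)
  obtain ⟨y, hy⟩ := hsim.exists_edgeTip x₁
  obtain ⟨a', ha'⟩ := (D.toFactor_castSucc_eq_iff i _ _).1
    ((hD.toFactor_eq_iff i.castSucc _ _).2 hy.sim_of_edgeTip)
  obtain rfl := hD.eq_of_edgeTip i hy h₀ ha'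
  -- The transported point `y` need not equal `y₁`; they only share their image in `B_{i+1}`, which
  -- `ψ` respects.
  have hyy : D.toFactor i.succ y = D.toFactor i.succ y₁ := by rw [← ha', h₁]
  have hψy := (hD'.toFactor_eq_iff _ _ _).2 (hψ.sim ((hD.toFactor_eq_iff _ _ _).1 hyy))
  have hcube := hψ.comp_isCubeMap hy
  rw [comp_edgeTip] at hcube
  exact hD'.eq_of_edgeTip i hcube h₀' (h₁'.trans hψy.symm)

theorem IsNilspaceMorphism.exists_factor_maps {X' : Type v} [Nilspace X] [Nilspace X']
    [Nonempty X] {ψ : X → X'}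
    (hψ : IsNilspaceMorphism ψ) {k : ℕ} {D : KFoldAbelianBundle.{u, w, z} k X}
    {D' : KFoldAbelianBundle.{v, w', z'} k X'} (hD : D.IsDegreeBundle)
    (hD' : D'.IsDegreeBundle) :
    ∃ (Ψ : ∀ i : Fin (k + 1), D.factor i → D'.factor i) (α : ∀ i : Fin k, D.group i →+ D'.group i),
      (∀ (i : Fin (k + 1)) (x : X), Ψ i (D.toFactor i x) = D'.toFactor i (ψ x)) ∧
      ∀ (i : Fin k) (b : D.factor i.succ) (a : D.group i),
        Ψ i.succ (a +ᵥ b) = α i a +ᵥ Ψ i.succ b := by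
  obtain ⟨x₀⟩ := ‹Nonempty X›
  have hresp : ∀ i x y, D.toFactor i x = D.toFactor i y →
      D'.toFactor i (ψ x) = D'.toFactor i (ψ y) := fun i x y h =>
    (hD'.toFactor_eq_iff i _ _).2 (hψ.sim ((hD.toFactor_eq_iff i _ _).1 h))
  let Ψ : ∀ i : Fin (k + 1), D.factor i → D'.factor i := fun i b =>
    D'.toFactor i (ψ (Function.surjInv (D.toFactor_surjective i) b))
  have hΨ : ∀ i x, Ψ i (D.toFactor i x) = D'.toFactor i (ψ x) := fun i x =>
    hresp i _ _ (Function.surjInv_eq (D.toFactor_surjective i) _)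
  have hex : ∀ (i : Fin k) (x : X) (a : D.group i), ∃ (y : X) (c : D'.group i),
      a +ᵥ D.toFactor i.succ x = D.toFactor i.succ y ∧
        c +ᵥ D'.toFactor i.succ (ψ x) = D'.toFactor i.succ (ψ y) := by
    intro i x a
    obtain ⟨y, hy⟩ := D.toFactor_surjective i.succ (a +ᵥ D.toFactor i.succ x)
    obtain ⟨c, hc⟩ := (D'.toFactor_castSucc_eq_iff i _ _).1
      (hresp _ _ _ ((D.toFactor_castSucc_eq_iff i x y).2 ⟨a, hy.symm⟩))
    exact ⟨y, c, hy.symm, hc⟩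
  choose y c hy hc using hex
  have hequi : ∀ (i : Fin k) (b : D.factor i.succ) (a : D.group i),
      Ψ i.succ (a +ᵥ b) = c i x₀ a +ᵥ Ψ i.succ b := by
    intro i b a
    obtain ⟨x, rfl⟩ := D.toFactor_surjective _ b
    rw [hy i x a, hΨ, hΨ, ← hc i x a,
      hψ.structure_unique hD hD' i (hy i x a) (hy i x₀ a) (hc i x a) (hc i x₀ a)]
  -- The homomorphism is read off at the base point `x₀`; additivity follows by cancelling the free
  -- action on the image of `x₀`.
  refine ⟨Ψ, fun i => AddMonoidHom.mk' (c i x₀) fun a a' => ?_, hΨ, hequi⟩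
  refine (D'.isAbelianBundle i).vadd_injective (b := Ψ i.succ (D.toFactor i.succ x₀)) ?_
  rw [← hequi, add_vadd, add_vadd, hequi, hequi]

end Nilspaces

theorem proposition3p3p4 (k : ℕ) (X : Type u) (X' : Type v)
    [Nilspaces.Nilspace X] [Nilspaces.Nilspace X'] [Nonempty X] [Nonempty X']
    (hX : Nilspaces.IsStep k X) (hX' : Nilspaces.IsStep k X')
    (ψ : X → X') (hψ : Nilspaces.IsNilspaceMorphism ψ) :
    -- the corresponding degree-`k` bundles exist
    (∃ D : Nilspaces.KFoldAbelianBundle.{u, u, u} k X,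
      D.IsDegreeBundle ∧ D.HasCharacteristicFactors) ∧
    (∃ D' : Nilspaces.KFoldAbelianBundle.{v, v, v} k X',
      D'.IsDegreeBundle ∧ D'.HasCharacteristicFactors) ∧
    -- and `ψ` is a bundle morphism for every choice of them
    ∀ (D : Nilspaces.KFoldAbelianBundle.{u, w, z} k X)
      (D' : Nilspaces.KFoldAbelianBundle.{v, w', z'} k X'),
      D.IsDegreeBundle → D'.IsDegreeBundle →
      Nilspaces.IsBundleMorphism D D' ψ ∧
      -- with induced maps on the factors and structure morphisms that are homomorphisms
      ∃ (Ψ : ∀ i : Fin (k + 1), D.factor i → D'.factor i)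
        (α : ∀ i : Fin k, D.group i →+ D'.group i),
        (∀ (i : Fin (k + 1)) (x : X), Ψ i (D.toFactor i x) = D'.toFactor i (ψ x)) ∧
        ∀ (i : Fin k) (b : D.factor i.succ) (a : D.group i),
          Ψ i.succ (a +ᵥ b) = α i a +ᵥ Ψ i.succ b := by
  refine ⟨Nilspaces.exists_characteristicBundle hX, Nilspaces.exists_characteristicBundle hX',
    fun D D' hD hD' => ?_⟩
  obtain ⟨Ψ, α, hΨ, hα⟩ := hψ.exists_factor_maps hD hD'
  exact ⟨⟨fun i x y h => by rw [← hΨ, ← hΨ, h], fun i => ⟨Ψ i.succ, α i, hΨ i.succ, hα i⟩⟩,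
    Ψ, α, hΨ, hα⟩
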